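/- Let $n\ge 2$ and $d\ge 1$ be integers, and let $S(n-2)\subset S(n-1)\subset S(n)$ be the natural embeddings ($S(0)$ is the trivial group). Let $V$ be the representation of $S(n)$ on $(\mathbb C^d)^{\otimes n}$ given by $V(\sigma)\,e_{i_1}\otimes\cdots\otimes e_{i_n}=e_{i_{\sigma^{-1}(1)}}\otimes\cdots\otimes e_{i_{\sigma^{-1}(n)}}$, let $t_n$ denote the partial transpose in the last tensor factor, and let $$A=A_n^{t_n}(d)=\operatorname{span}_{\mathbb C}\{V(\sigma)^{t_n}:\sigma\in S(n)\},\qquad M=\operatorname{span}_{\mathbb C}\{V(\sigma)^{t_n}:\sigma\in S(n),\ \sigma(n)\neq n\}.$$ $A$ is an algebra of operators containing $V(\sigma)^{t_n}=V(\sigma)$ for all $\sigma\in S(n-1)$, and $M$ is an ideal of $A$. For an irreducible unitary matrix representation $\varphi^\alpha=(\varphi^\alpha_{ij})$ of $S(n-2)$, of dimension $w^\alpha$, let $\operatorname{Ind}\varphi^\alpha=\operatorname{Ind}_{S(n-2)}^{S(n-1)}\varphi^\alpha$ be the induced representation in the matrix form belonging to the coset representatives $(a\ n-1)$, $a=1,\dots,n-1$: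 $$(\operatorname{Ind}\varphi^\alpha)_{ai,bj}(\sigma)=\begin{cases}\varphi^\alpha_{ij}[(a\ n-1)\,\sigma\,(b\ n-1)]&\text{if }(a\ n-1)\,\sigma\,(b\ n-1)\in S(n-2),\\0&\text{otherwise.}\end{cases}$$ Here $(a\,a)$ means the identity. Let $Q(\alpha)$ be the matrix of size $(n-1)w^\alpha$ with entries $$Q^{ab}_{ij}(\alpha)=d^{\delta_{ab}}\varphi^\alpha_{ij}[(a\ n-1)(a\,b)(b\ n-1)],\qquad a,b=1,\dots,n-1,\quad i,j=1,\dots,w^\alpha,$$ and let $U(\alpha)\subset M$ be the span of the elements $$u^{ab}_{ij}(\alpha)=\frac{w^\alpha}{(n-2)!}\,V(a\,n)^{t_n}\sum_{\sigma\in S(n-2)}\varphi^\alpha_{ji}(\sigma^{-1})\,V[(a\ n-1)\,\sigma\,(b\ n-1)].$$ By an irreducible representation $\Phi_A^\alpha$ we mean a minimal left ideal of $A$ contained in $U(\alpha)$; it is a representation of $S(n-1)$ through left multiplication by $V(\sigma)$, $\sigma\in S(n-1)$. (A) Suppose $d>n-2$. Then, for every $\alpha$, the matrix $Q(\alpha)$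 is positive definite; in particular $\det Q(\alpha)\ne0$. Every minimal left ideal of $A$ contained in $M$ is contained in $U(\alpha)$ for some $\alpha$. For every $\alpha$ a representation $\Phi_A^\alpha$ exists, and every $\Phi_A^\alpha$ is, as a representation of $S(n-1)$, isomorphic to $\operatorname{Ind}\varphi^\alpha$ and has dimension $(n-1)\dim\varphi^\alpha$. (B) Suppose $d\le n-2$. Then there is an irreducible unitary representation $\varphi^\alpha$ of $S(n-2)$, occurring in the restriction of $V$ to $S(n-2)$, with $\det Q(\alpha)=0$. For every $\alpha$ such that $\varphi^\alpha$ occurs in the restriction of $V$ to $S(n-2)$ and $\det Q(\alpha)=0$, a representation $\Phi_A^\alpha$ exists, and every $\Phi_A^\alpha$ is, as a representation of $S(n-1)$, isomorphic to the proper subrepresentation of $\operatorname{Ind}\varphi^\alpha$ carried by the range of $Q(\alpha)$. -/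

import Mathlib

open scoped ComplexOrder

noncomputable section

namespace PartialTranspose

open Equiv

/-! ### Symmetric groups

Throughout `n = m + 2`, so that `S(n-2) = Perm (Fin m)`, `S(n-1) = Perm (Fin (m+1))` and
`S(n) = Perm (Fin (m+2))`. The paper's index `a ∈ {1, …, n-1}` is `a : Fin (m+1)`, and the last
point of `Fin (m+1)` is the paper's `n-1`, the last point of `Fin (m+2)` is the paper's `n`. -/

/-- The natural embedding `S(k) ⊂ S(k+1)`: permutations of the first `k` points, extended so as to
fix the last point. -/
def symIncl (k : ℕ) : Perm (Fin k) →* Perm (Fin (k + 1)) :=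
  Perm.viaEmbeddingHom (Fin.castSuccEmb : Fin k ↪ Fin (k + 1))

theorem symIncl_injective (k : ℕ) : Function.Injective (symIncl k) :=
  Perm.viaEmbeddingHom_injective _

theorem symIncl_last (k : ℕ) (σ : Perm (Fin k)) : symIncl k σ (Fin.last k) = Fin.last k := by
  refine Perm.viaEmbedding_apply_of_notMem σ (Fin.castSuccEmb : Fin k ↪ Fin (k + 1)) _ ?_
  rintro ⟨x, hx⟩
  exact (Fin.castSucc_lt_last x).ne hx

theorem symIncl_castSucc (k : ℕ) (σ : Perm (Fin k)) (x : Fin k) :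
    symIncl k σ x.castSucc = (σ x).castSucc :=
  Perm.viaEmbedding_apply σ (Fin.castSuccEmb : Fin k ↪ Fin (k + 1)) x

theorem mem_range_symIncl (k : ℕ) (σ : Perm (Fin (k + 1))) :
    σ ∈ (symIncl k).range ↔ σ (Fin.last k) = Fin.last k := by
  constructor
  · rintro ⟨τ, rfl⟩
    exact symIncl_last k τ
  · intro h
    have h' : σ⁻¹ (Fin.last k) = Fin.last k := by
      rw [Perm.inv_eq_iff_eq, h]
    have key : ∀ (τ : Perm (Fin (k + 1))), τ (Fin.last k) = Fin.last k →
        ∀ x : Fin k, τ x.castSucc ≠ Fin.last k := by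
      intro τ hτ x hx
      exact (Fin.castSucc_lt_last x).ne (τ.injective (hx.trans hτ.symm))
    refine ⟨⟨fun x => (σ x.castSucc).castPred (key σ h x),
      fun x => (σ⁻¹ x.castSucc).castPred (key σ⁻¹ h' x), fun x => ?_, fun x => ?_⟩, ?_⟩
    · apply Fin.castSucc_injective
      simp
    · apply Fin.castSucc_injective
      simp
    · ext x
      refine Fin.lastCases ?_ (fun x => ?_) x
      · rw [symIncl_last, h]
      · rw [symIncl_castSucc]
        simp

/-! ### The algebra of partially transposed permutation operators

`(ℂ^d)^{⊗ k}` has the basis `e_{i_1} ⊗ ⋯ ⊗ e_{i_k}`, indexed by the functions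
`Fin k → Fin d`; its operators are the matrices over this index set. -/

/-- The operators on `(ℂ^d)^{⊗ k}`, as matrices in the standard product basis. -/
abbrev Op (d k : ℕ) := Matrix (Fin k → Fin d) (Fin k → Fin d) ℂ

/-- The representation `V` of `S(k)` on `(ℂ^d)^{⊗ k}` permuting tensor factors,
`V(σ) e_{i_1} ⊗ ⋯ ⊗ e_{i_k} = e_{i_{σ⁻¹(1)}} ⊗ ⋯ ⊗ e_{i_{σ⁻¹(k)}}`. -/
def permOp (d k : ℕ) : Perm (Fin k) →* Op d k where
  toFun σ := Matrix.of fun x y => if x = y ∘ ⇑(σ⁻¹) then 1 else 0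
  map_one' := by
    ext x y
    simp [Matrix.one_apply]
  map_mul' σ τ := by
    ext x z
    simp only [Matrix.mul_apply, Matrix.of_apply, mul_ite, mul_one, mul_zero]
    rw [Finset.sum_ite_eq' Finset.univ (z ∘ ⇑τ⁻¹)]
    simp only [Finset.mem_univ, if_true, mul_inv_rev]
    rfl

/-- The partial transpose `X ↦ X^{t_n}` in the last tensor factor: the last components of the
row index and of the column index are exchanged. -/
def partialTranspose {d k : ℕ} (X : Op d (k + 1)) : Op d (k + 1) :=
  Matrix.of fun x y =>
    X (Function.update x (Fin.last k) (y (Fin.last k)))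
      (Function.update y (Fin.last k) (x (Fin.last k)))

/-- The natural generators `V(σ)^{t_n}`, `σ ∈ S(n)`, where `n = m + 2`. -/
def ptOp (m d : ℕ) (σ : Perm (Fin (m + 2))) : Op d (m + 2) :=
  partialTranspose (permOp d (m + 2) σ)

/-- The algebra `A_n^{t_n}(d) = span {V(σ)^{t_n} : σ ∈ S(n)}`. -/
def algA (m d : ℕ) : Submodule ℂ (Op d (m + 2)) :=
  Submodule.span ℂ (Set.range (ptOp m d))

/-- The ideal `M = span {V(σ)^{t_n} : σ ∈ S(n), σ(n) ≠ n}`. -/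
def idealM (m d : ℕ) : Submodule ℂ (Op d (m + 2)) :=
  Submodule.span ℂ {X | ∃ σ : Perm (Fin (m + 2)),
    σ (Fin.last (m + 1)) ≠ Fin.last (m + 1) ∧ X = ptOp m d σ}

/-- `L` is a left ideal of `A_n^{t_n}(d)`. -/
structure IsLeftIdeal (m d : ℕ) (L : Submodule ℂ (Op d (m + 2))) : Prop where
  le : L ≤ algA m d
  mul_mem : ∀ a ∈ algA m d, ∀ x ∈ L, a * x ∈ L

/-- `L` is a minimal left ideal of `A_n^{t_n}(d)`, that is, an irreducible representation of
`A_n^{t_n}(d)` contained in its left regular representation. -/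
structure IsMinimalLeftIdeal (m d : ℕ) (L : Submodule ℂ (Op d (m + 2))) : Prop extends
    IsLeftIdeal m d L where
  ne_bot : L ≠ ⊥
  minimal : ∀ L' : Submodule ℂ (Op d (m + 2)), IsLeftIdeal m d L' → L' ≤ L → L' = ⊥ ∨ L' = L

/-- The partial transpose does not change `V(σ)` for `σ ∈ S(n-1)`. -/
theorem ptOp_symIncl (m d : ℕ) (σ : Perm (Fin (m + 1))) :
    ptOp m d (symIncl (m + 1) σ) = permOp d (m + 2) (symIncl (m + 1) σ) := by
  ext x y
  have hl : (symIncl (m + 1) σ)⁻¹ (Fin.last (m + 1)) = Fin.last (m + 1) := by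
    rw [← map_inv, symIncl_last]
  have hc : ∀ i : Fin (m + 1), (symIncl (m + 1) σ)⁻¹ i.castSucc = (σ⁻¹ i).castSucc := by
    intro i
    rw [← map_inv, symIncl_castSucc]
  have hne : ∀ i : Fin (m + 1), i.castSucc ≠ Fin.last (m + 1) :=
    fun i => (Fin.castSucc_lt_last i).ne
  have : (Function.update x (Fin.last (m + 1)) (y (Fin.last (m + 1))) =
      Function.update y (Fin.last (m + 1)) (x (Fin.last (m + 1))) ∘
        ⇑((symIncl (m + 1) σ)⁻¹)) ↔ x = y ∘ ⇑((symIncl (m + 1) σ)⁻¹) := by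
    simp only [funext_iff, Fin.forall_fin_succ', Function.comp_apply, hl, hc,
      Function.update_self, ne_eq, hne, not_false_eq_true, Function.update_of_ne]
    constructor
    · rintro ⟨h1, h2⟩
      exact ⟨h1, h2.symm⟩
    · rintro ⟨h1, h2⟩
      exact ⟨h1, h2.symm⟩
  change (if _ then (1 : ℂ) else 0) = if _ then (1 : ℂ) else 0
  simp only [this]

theorem permOp_mem_algA (m d : ℕ) (σ : Perm (Fin (m + 1))) :
    permOp d (m + 2) (symIncl (m + 1) σ) ∈ algA m d := by
  rw [← ptOp_symIncl]
  exact Submodule.subset_span ⟨_, rfl⟩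

/-- The restriction to `S(n-1)` of the representation of `A_n^{t_n}(d)` on a left ideal `L`:
`σ ∈ S(n-1)` acts on `L` as left multiplication by `V(σ)`. -/
def leftIdealRep {m d : ℕ} {L : Submodule ℂ (Op d (m + 2))} (hL : IsLeftIdeal m d L) :
    Representation ℂ (Perm (Fin (m + 1))) L where
  toFun σ := (LinearMap.mulLeft ℂ (permOp d (m + 2) (symIncl (m + 1) σ))).restrict
    (fun x hx => hL.mul_mem _ (permOp_mem_algA m d σ) x hx)
  map_one' := by
    ext x : 2
    simp
  map_mul' σ τ := by
    ext x : 2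
    change permOp d (m + 2) (symIncl (m + 1) (σ * τ)) * (x : Op d (m + 2)) =
      permOp d (m + 2) (symIncl (m + 1) σ) * (permOp d (m + 2) (symIncl (m + 1) τ) * x)
    rw [map_mul, map_mul, mul_assoc]

/-! ### Representations -/

/-- The representation on column vectors given by a matrix representation. -/
def matRep {G ι : Type*} [Monoid G] [Fintype ι] [DecidableEq ι] (φ : G →* Matrix ι ι ℂ) :
    Representation ℂ G (ι → ℂ) :=
  (Matrix.toLinAlgEquiv' : Matrix ι ι ℂ ≃ₐ[ℂ] ((ι → ℂ) →ₗ[ℂ] (ι → ℂ))).toAlgHom.toMonoidHom.comp φ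

theorem matRep_apply {G ι : Type*} [Monoid G] [Fintype ι] [DecidableEq ι]
    (φ : G →* Matrix ι ι ℂ) (g : G) (v : ι → ℂ) : matRep φ g v = (φ g).mulVec v := rfl

/-- An irreducible unitary matrix representation `φ^α` of `S(m)`, of dimension `w^α = dim`. -/
structure UnitaryIrrep (m : ℕ) where
  dim : ℕ
  mat : Perm (Fin m) →* Matrix (Fin dim) (Fin dim) ℂ
  unitary : ∀ σ, mat σ ∈ Matrix.unitaryGroup (Fin dim) ℂ
  irreducible : (matRep mat).IsIrreducible

/-- For a subgroup `j : H → G` and a matrix representation `φ` of `H`: `φ̂(g) = φ(g)` if `g ∈ H`,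
and `φ̂(g) = 0` otherwise. -/
def hat {G H κ : Type*} [Group G] [Group H] [Fintype κ] [DecidableEq κ] (j : H →* G)
    (φ : H →* Matrix κ κ ℂ) (g : G) : Matrix κ κ ℂ :=
  open Classical in if h : g ∈ j.range then φ (Classical.choose h) else 0

section hat

variable {G H κ ι : Type*} [Group G] [Group H] [Fintype κ] [DecidableEq κ]

theorem hat_apply (j : H →* G) (hj : Function.Injective j) (φ : H →* Matrix κ κ ℂ) (h : H) :
    hat j φ (j h) = φ h := by
  have hm : j h ∈ j.range := ⟨h, rfl⟩
  rw [hat, dif_pos hm]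
  exact congrArg φ (hj (Classical.choose_spec hm))

theorem hat_of_notMem (j : H →* G) (φ : H →* Matrix κ κ ℂ) {g : G} (hg : g ∉ j.range) :
    hat j φ g = 0 := dif_neg hg

theorem hat_mul (j : H →* G) (hj : Function.Injective j) (φ : H →* Matrix κ κ ℂ) (g : G) {k : G}
    (hk : k ∈ j.range) : hat j φ (g * k) = hat j φ g * hat j φ k := by
  by_cases hg : g ∈ j.range
  · obtain ⟨a, rfl⟩ := hg
    obtain ⟨b, rfl⟩ := hk
    rw [← map_mul, hat_apply j hj, hat_apply j hj, hat_apply j hj, map_mul]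
  · have : g * k ∉ j.range := fun h => hg ((Subgroup.mul_mem_cancel_right _ hk).1 h)
    rw [hat_of_notMem j φ hg, hat_of_notMem j φ this, zero_mul]

/-- The matrix form of the representation of `G` induced by a matrix representation `φ` of a
subgroup `j : H → G`, for a family `t` of representatives of the left cosets of `H` in `G`:
`π_{ai,bj}(g) = φ̂_{ij}(t_a⁻¹ g t_b)`. -/
def inducedMat [Fintype ι] [DecidableEq ι] (j : H →* G) (hj : Function.Injective j)
    (t : ι → G) (ht : ∀ g : G, ∃! a, (t a)⁻¹ * g ∈ j.range)
    (φ : H →* Matrix κ κ ℂ) : G →* Matrix (ι × κ) (ι × κ) ℂ where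
  toFun g := Matrix.of fun p q => hat j φ ((t p.1)⁻¹ * g * t q.1) p.2 q.2
  map_one' := by
    ext ⟨a, i⟩ ⟨b, k⟩
    by_cases hab : a = b
    · subst hab
      have h1 : (t a)⁻¹ * 1 * t a = j 1 := by simp
      rw [Matrix.of_apply, h1, hat_apply j hj, map_one]
      simp [Matrix.one_apply]
    · have : (t a)⁻¹ * 1 * t b ∉ j.range := by
        intro h
        apply hab
        refine (ht (t b)).unique ?_ ?_
        · simpa using h
        · simp
      simp only [Matrix.of_apply, hat_of_notMem j φ this]
      simp [hab]
  map_mul' x y := by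
    ext ⟨a, i⟩ ⟨c, k⟩
    obtain ⟨b, hb, hb'⟩ := ht (y * t c)
    simp only [Matrix.mul_apply, Matrix.of_apply, Fintype.sum_prod_type]
    rw [Finset.sum_eq_single b]
    · have hb2 : (t b)⁻¹ * y * t c ∈ j.range := by simpa [mul_assoc] using hb
      have : (t a)⁻¹ * (x * y) * t c = ((t a)⁻¹ * x * t b) * ((t b)⁻¹ * y * t c) := by group
      rw [this, hat_mul j hj φ _ hb2, Matrix.mul_apply]
    · intro b₁ _ hne
      have : (t b₁)⁻¹ * y * t c ∉ j.range := by
        intro h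
        exact hne (hb' b₁ (by simpa [mul_assoc] using h))
      simp [hat_of_notMem j φ this]
    · simp

end hat

/-- The representatives `(a n-1)`, `a = 1, …, n-1`, of the left cosets of `S(n-2)` in `S(n-1)`;
for `a = n-1` this is the identity. -/
def cosetRep (m : ℕ) (a : Fin (m + 1)) : Perm (Fin (m + 1)) := swap a (Fin.last m)

theorem cosetRep_spec (m : ℕ) (g : Perm (Fin (m + 1))) :
    ∃! a, (cosetRep m a)⁻¹ * g ∈ (symIncl m).range := by
  have key : ∀ a, (cosetRep m a)⁻¹ * g ∈ (symIncl m).range ↔ a = g (Fin.last m) := by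
    intro a
    rw [mem_range_symIncl, Perm.mul_apply, Perm.inv_eq_iff_eq, cosetRep, swap_apply_right, eq_comm]
  exact ⟨g (Fin.last m), (key _).2 rfl, fun b hb => (key b).1 hb⟩

namespace UnitaryIrrep

variable {m : ℕ} (α : UnitaryIrrep m)

/-- The induced representation `Ind_{S(n-2)}^{S(n-1)}(φ^α)`, in matrix form. -/
def ind : Perm (Fin (m + 1)) →*
    Matrix (Fin (m + 1) × Fin α.dim) (Fin (m + 1) × Fin α.dim) ℂ :=
  inducedMat (symIncl m) (symIncl_injective m) (cosetRep m) (cosetRep_spec m) α.mat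

/-- The matrix `Q(α)`, with entries
`Q^{ab}_{ij} = d^{δ_{ab}} φ^α_{ij}[(a n-1)(a b)(b n-1)]`. The permutation in brackets always lies in
`S(n-2)`. -/
def Q (d : ℕ) : Matrix (Fin (m + 1) × Fin α.dim) (Fin (m + 1) × Fin α.dim) ℂ :=
  Matrix.of fun p q =>
    (if p.1 = q.1 then (d : ℂ) else 1) *
      hat (symIncl m) α.mat
        (swap p.1 (Fin.last m) * swap p.1 q.1 * swap q.1 (Fin.last m)) p.2 q.2

/-- The elements
`u^{ab}_{ij}(α) = (w^α / (n-2)!) V(a n)^{t_n} ∑_{σ ∈ S(n-2)} φ^α_{ji}(σ⁻¹) V[(a n-1) σ (b n-1)]`. -/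
def u (d : ℕ) (a b : Fin (m + 1)) (i k : Fin α.dim) : Op d (m + 2) :=
  ((α.dim : ℂ) / (m.factorial : ℂ)) •
    (ptOp m d (swap a.castSucc (Fin.last (m + 1))) *
      ∑ σ : Perm (Fin m), α.mat σ⁻¹ k i •
        permOp d (m + 2) (symIncl (m + 1)
          (swap a (Fin.last m) * symIncl m σ * swap b (Fin.last m))))

/-- The ideal `U(α) = span {u^{ab}_{ij}(α)}`. -/
def idealU (d : ℕ) : Submodule ℂ (Op d (m + 2)) :=
  Submodule.span ℂ {X | ∃ a b i k, X = α.u d a b i k}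

/-- `φ^α ∈ V_d[S(n-2)]`: the irreducible representation `φ^α` occurs in the representation of
`S(n-2) ⊂ S(n)` on `(ℂ^d)^{⊗ n}`. -/
def Occurs (d : ℕ) : Prop :=
  ∃ f : (matRep α.mat).IntertwiningMap
    (matRep ((permOp d (m + 2)).comp ((symIncl (m + 1)).comp (symIncl m)))), f ≠ 0

/-- `L` carries an irreducible representation `Φ_A^α`: it is a minimal left ideal of
`A_n^{t_n}(d)` contained in `U(α)`. -/
structure IsPhi (d : ℕ) (L : Submodule ℂ (Op d (m + 2))) : Prop extends
    IsMinimalLeftIdeal m d L where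
  le_idealU : L ≤ α.idealU d

end UnitaryIrrep

end PartialTranspose

end

open PartialTranspose

noncomputable section

namespace PartialTranspose

open Equiv
open scoped Matrix

/-! ### Operators -/

/-! Write V(g) for `liftOp` and P_a for `pairOp`. The algebra A is spanned by the V(g) and the V(g)
P_a, with relations V(g) P_a = P_{g a} V(g) and P_a P_b = d^{δ_ab} V(a b) P_b. Let e_ij be the
matrix units of φ^α, realised on tensors. Then u^{ab}_{ij} = V(a n-1) P_{n-1} e_ij V(b n-1), and for
pairs p = (a,i) these multiply by u_pq u_rs = Q_qr u_ps (`u_mul_u`). So U(α) is a quotient of the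
matrices with product Y Q X (`uMap_mul_uMap`), on which V(g) acts by left multiplication with Ind
φ^α(g) (`liftOp_mul_uMap`). Since U(α) is closed under adjoints, ∑ X_pq u_pq vanishes whenever Q X Q
= 0; the converse holds when φ^α occurs (`uMap_eq_zero_iff`). In that case every minimal left ideal
in U(α) consists of the elements with X = v rᵀ for a fixed r with rᵀ Q ≠ 0, and v counts only modulo
ker Q. As Q commutes with Ind φ^α (`ind_mul_Q`), such an ideal is ℂ^N / ker Q ≅ range Q, with N =
(n-1) w^α (`exists_intertwiner`). Both halves of the theorem thus reduce to whether Q is invertible.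
An intertwiner F from φ^α into tensors that are maximally entangled in the last two factors makes Q
a positive multiple of the Gram matrix of T : (v_a) ↦ ∑ V(a n-1) F v_a. If d > n-2, some basis
vector of ℂ^d is missing from the first n-2 places, and this separates the summands, so T is
injective (`Q_posDef`). If d ≤ n-2, antisymmetrising d+1 factors of ℂ^d gives zero, and this linear
relation yields a kernel vector of some Q(α) (`exists_occurs_det_Q_eq_zero`). A minimal left ideal
in M meets some U(α), because a nonzero element of M is not killed by every P_a
(`exists_isPhi_of_isMinimalLeftIdeal`). -/

theorem permOp_mul_apply {d k : ℕ} {ι : Type*} (σ : Perm (Fin k)) (X : Matrix (Fin k → Fin d) ι ℂ)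
    (x : Fin k → Fin d) (y : ι) : (permOp d k σ * X) x y = X (x ∘ σ) y := by
  have h : ∀ z : Fin k → Fin d, x = z ∘ ⇑σ⁻¹ ↔ x ∘ σ = z := by
    intro z
    constructor
    · rintro rfl
      ext i
      simp
    · rintro rfl
      ext i
      simp
  simp only [Matrix.mul_apply, permOp, MonoidHom.coe_mk, OneHom.coe_mk, Matrix.of_apply, h]
  simp

theorem permOp_conjTranspose {d k : ℕ} (σ : Perm (Fin k)) :
    (permOp d k σ)ᴴ = permOp d k σ⁻¹ := by
  ext x y
  have h : y = x ∘ ⇑σ⁻¹ ↔ x = y ∘ σ := by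
    constructor
    · rintro rfl
      ext i
      simp
    · rintro rfl
      ext i
      simp
  simp only [Matrix.conjTranspose_apply, permOp, MonoidHom.coe_mk, OneHom.coe_mk, Matrix.of_apply,
    h, inv_inv]
  split_ifs <;> simp

theorem mul_permOp_apply {d k : ℕ} {ι : Type*} (σ : Perm (Fin k)) (X : Matrix ι (Fin k → Fin d) ℂ)
    (x : ι) (y : Fin k → Fin d) : (X * permOp d k σ) x y = X x (y ∘ ⇑σ⁻¹) := by
  simp [Matrix.mul_apply, permOp]

/-- The operators `V(g)` for `g ∈ S(n-1) ⊂ S(n)`. -/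
def liftOp (m d : ℕ) : Perm (Fin (m + 1)) →* Op d (m + 2) :=
  (permOp d (m + 2)).comp (symIncl (m + 1))

/-- The operators `V(a n)^{t_n}`. -/
def pairOp (m d : ℕ) (a : Fin (m + 1)) : Op d (m + 2) :=
  ptOp m d (swap a.castSucc (Fin.last (m + 1)))

variable {m d : ℕ}

theorem liftOp_conjTranspose (g : Perm (Fin (m + 1))) : (liftOp m d g)ᴴ = liftOp m d g⁻¹ := by
  simp [liftOp, permOp_conjTranspose]

theorem update_comp_symIncl {k : ℕ} {β : Type*} (g : Perm (Fin k)) (x : Fin (k + 1) → β) (s : β) :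
    Function.update x (Fin.last k) s ∘ ⇑(symIncl k g) =
      Function.update (x ∘ ⇑(symIncl k g)) (Fin.last k) s := by
  ext i
  refine Fin.lastCases ?_ (fun i => ?_) i
  · simp [symIncl_last]
  · simp [symIncl_castSucc]

/-- V(g) with g ∈ S(n-1) acts as the identity on the transposed factor, so it can be pulled out of
the partial transpose. -/
theorem ptOp_symIncl_mul (g : Perm (Fin (m + 1))) (σ : Perm (Fin (m + 2))) :
    ptOp m d (symIncl (m + 1) g * σ) = liftOp m d g * ptOp m d σ := by
  ext x y
  rw [liftOp, MonoidHom.comp_apply, permOp_mul_apply, ptOp, ptOp, map_mul, partialTranspose,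
    Matrix.of_apply, permOp_mul_apply, update_comp_symIncl, partialTranspose, Matrix.of_apply,
    Function.comp_apply, symIncl_last]

theorem ptOp_mul_symIncl (g : Perm (Fin (m + 1))) (σ : Perm (Fin (m + 2))) :
    ptOp m d (σ * symIncl (m + 1) g) = ptOp m d σ * liftOp m d g := by
  ext x y
  rw [liftOp, MonoidHom.comp_apply, mul_permOp_apply, ptOp, ptOp, map_mul, partialTranspose,
    Matrix.of_apply, mul_permOp_apply, ← map_inv, update_comp_symIncl, partialTranspose,
    Matrix.of_apply, Function.comp_apply, symIncl_last]

theorem symIncl_mul_swap (g : Perm (Fin (m + 1))) (a : Fin (m + 1)) :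
    symIncl (m + 1) g * swap a.castSucc (Fin.last (m + 1)) =
      swap (g a).castSucc (Fin.last (m + 1)) * symIncl (m + 1) g := by
  rw [mul_swap_eq_swap_mul, symIncl_castSucc, symIncl_last]

theorem liftOp_mul_pairOp (g : Perm (Fin (m + 1))) (a : Fin (m + 1)) :
    liftOp m d g * pairOp m d a = pairOp m d (g a) * liftOp m d g := by
  rw [pairOp, pairOp, ← ptOp_symIncl_mul, symIncl_mul_swap, ptOp_mul_symIncl]

/-- Transposing one leg of a swap gives the unnormalised projection onto the maximally entangled
vector of factors a and n. -/
theorem pairOp_apply (a : Fin (m + 1)) (x y : Fin (m + 2) → Fin d) :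
    pairOp m d a x y = if x a.castSucc = x (Fin.last _) ∧ y a.castSucc = y (Fin.last _) ∧
      ∀ c, c ≠ a → x c.castSucc = y c.castSucc then 1 else 0 := by
  have key : Function.update x (Fin.last (m + 1)) (y (Fin.last (m + 1))) =
      Function.update y (Fin.last (m + 1)) (x (Fin.last (m + 1))) ∘
        ⇑(swap a.castSucc (Fin.last (m + 1)))⁻¹ ↔
      x a.castSucc = x (Fin.last _) ∧ y a.castSucc = y (Fin.last _) ∧
      ∀ c, c ≠ a → x c.castSucc = y c.castSucc := by
    rw [funext_iff, Fin.forall_fin_succ']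
    simp only [swap_inv, Function.comp_apply, swap_apply_right, Function.update_self, ne_eq,
      (Fin.castSucc_lt_last _).ne, not_false_eq_true, Function.update_of_ne]
    constructor
    · rintro ⟨h1, h2⟩
      refine ⟨by simpa using h1 a, h2.symm, fun c hc => ?_⟩
      have := h1 c
      rwa [swap_apply_of_ne_of_ne (by simpa using hc) (Fin.castSucc_lt_last _).ne,
        Function.update_of_ne (Fin.castSucc_lt_last _).ne] at this
    · rintro ⟨h1, h2, h3⟩
      refine ⟨fun c => ?_, h2.symm⟩
      by_cases hc : c = a
      · subst hc
        simpa using h1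
      · rw [swap_apply_of_ne_of_ne (by simpa using hc) (Fin.castSucc_lt_last _).ne,
          Function.update_of_ne (Fin.castSucc_lt_last _).ne, h3 c hc]
  change (if _ then (1 : ℂ) else 0) = _
  simp only [key]

theorem pairOp_conjTranspose (a : Fin (m + 1)) : (pairOp m d a)ᴴ = pairOp m d a := by
  ext x y
  rw [Matrix.conjTranspose_apply, pairOp_apply, pairOp_apply]
  have : (y a.castSucc = y (Fin.last _) ∧ x a.castSucc = x (Fin.last _) ∧
      ∀ c, c ≠ a → y c.castSucc = x c.castSucc) ↔ (x a.castSucc = x (Fin.last _) ∧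
      y a.castSucc = y (Fin.last _) ∧ ∀ c, c ≠ a → x c.castSucc = y c.castSucc) := by
    grind
  simp only [this]
  split_ifs <;> simp

/-- `x` with both the entry at `a` and the last entry replaced by `s`. -/
def pairUpdate (a : Fin (m + 1)) (x : Fin (m + 2) → Fin d) (s : Fin d) : Fin (m + 2) → Fin d :=
  Function.update (Function.update x a.castSucc s) (Fin.last (m + 1)) s

theorem pairUpdate_last (a : Fin (m + 1)) (x : Fin (m + 2) → Fin d) (s : Fin d) :
    pairUpdate a x s (Fin.last _) = s := by simp [pairUpdate]

theorem pairUpdate_castSucc (a : Fin (m + 1)) (x : Fin (m + 2) → Fin d) (s : Fin d)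
    (c : Fin (m + 1)) :
    pairUpdate a x s c.castSucc = if c = a then s else x c.castSucc := by
  rw [pairUpdate, Function.update_of_ne (Fin.castSucc_lt_last _).ne, Function.update_apply]
  simp

theorem pairUpdate_injective (a : Fin (m + 1)) (x : Fin (m + 2) → Fin d) :
    Function.Injective (pairUpdate a x) := by
  intro s t h
  simpa [pairUpdate_last] using congrFun h (Fin.last _)

theorem pairOp_mul_apply {ι : Type*} (a : Fin (m + 1)) (X : Matrix (Fin (m + 2) → Fin d) ι ℂ)
    (x : Fin (m + 2) → Fin d) (z : ι) :
    (pairOp m d a * X) x z =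
      if x a.castSucc = x (Fin.last _) then ∑ s, X (pairUpdate a x s) z else 0 := by
  split_ifs with hx
  · rw [Matrix.mul_apply, ← Finset.sum_subset (Finset.subset_univ
      (Finset.univ.map ⟨pairUpdate a x, pairUpdate_injective a x⟩)), Finset.sum_map]
    · refine Finset.sum_congr rfl fun s _ => ?_
      rw [pairOp_apply, if_pos, one_mul]
      · rfl
      · refine ⟨hx, ?_, fun c hc => ?_⟩
        · simp [pairUpdate_last, pairUpdate_castSucc]
        · simp [pairUpdate_castSucc, hc]
    · intro y _ hy
      rw [pairOp_apply, if_neg, zero_mul]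
      rintro ⟨-, h2, h3⟩
      apply hy
      simp only [Finset.mem_map, Finset.mem_univ, true_and]
      refine ⟨y (Fin.last _), ?_⟩
      ext i
      refine congrArg _ (Fin.lastCases ?_ (fun c => ?_) i)
      · exact pairUpdate_last _ _ _
      · refine (pairUpdate_castSucc _ _ _ _).trans ?_
        split_ifs with hc
        · rw [hc, h2]
        · exact h3 c hc
  · rw [Matrix.mul_apply]
    refine Finset.sum_eq_zero fun y _ => ?_
    rw [pairOp_apply, if_neg, zero_mul]
    exact fun h => hx h.1

theorem pairOp_mul_pairOp (a b : Fin (m + 1)) :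
    pairOp m d a * pairOp m d b =
      (if a = b then (d : ℂ) else 1) • (liftOp m d (swap a b) * pairOp m d b) := by
  ext x z
  rw [pairOp_mul_apply, Matrix.smul_apply, liftOp, MonoidHom.comp_apply, permOp_mul_apply]
  simp only [pairOp_apply, pairUpdate_last, pairUpdate_castSucc, Function.comp_apply,
    symIncl_castSucc, symIncl_last]
  by_cases hab : a = b
  · subst hab
    simp only [swap_self, Equiv.refl_apply, if_true, true_and]
    by_cases hx : x a.castSucc = x (Fin.last _)
    · have h : ∀ s : Fin d, (∀ c, c ≠ a → (if c = a then s else x c.castSucc) = z c.castSucc) ↔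
          ∀ c, c ≠ a → x c.castSucc = z c.castSucc := by
        refine fun s => forall_congr' fun c => imp_congr_right fun hc => ?_
        rw [if_neg hc]
      simp only [hx, if_true, true_and, smul_eq_mul, h]
      rw [Finset.sum_const, Finset.card_univ, Fintype.card_fin, nsmul_eq_mul]
    · simp [hx]
  · simp only [hab, if_false, one_smul, Ne.symm hab, swap_apply_right]
    by_cases hx : x a.castSucc = x (Fin.last _)
    · simp only [hx, if_true, true_and]
      -- The pairing of b with n forces the summation variable; for a = b it was free, which
      -- produced the factor d.
      rw [Finset.sum_eq_single (x b.castSucc)]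
      · congr 1
        refine propext ⟨?_, ?_⟩
        · rintro ⟨-, h2, h3⟩
          refine ⟨h2, fun c hc => ?_⟩
          have := h3 c hc
          by_cases hca : c = a
          · subst hca
            simpa using this
          · rw [if_neg hca] at this
            rwa [swap_apply_of_ne_of_ne hca hc]
        · rintro ⟨h2, h3⟩
          refine ⟨rfl, h2, fun c hc => ?_⟩
          have := h3 c hc
          by_cases hca : c = a
          · subst hca
            simpa using this
          · rw [if_neg hca]
            rwa [swap_apply_of_ne_of_ne hca hc] at this
      · intro s _ hs
        rw [if_neg]
        exact fun h => hs h.1.symm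
      · simp
    · simp [hx]

/-! ### Spanning sets of A and of M -/

theorem exists_symIncl_of_apply_last {σ : Perm (Fin (m + 2))}
    (h : σ (Fin.last (m + 1)) = Fin.last (m + 1)) : ∃ g, σ = symIncl (m + 1) g := by
  obtain ⟨g, hg⟩ := (mem_range_symIncl _ _).2 h
  exact ⟨g, hg.symm⟩

theorem exists_symIncl_mul_swap {σ : Perm (Fin (m + 2))}
    (h : σ (Fin.last (m + 1)) ≠ Fin.last (m + 1)) :
    ∃ (g : Perm (Fin (m + 1))) (a : Fin (m + 1)), σ = symIncl (m + 1) g * swap a.castSucc (Fin.last (m + 1)) := by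
  have h' : σ⁻¹ (Fin.last (m + 1)) ≠ Fin.last (m + 1) := by
    intro h'
    rw [Perm.inv_eq_iff_eq] at h'
    exact h h'.symm
  obtain ⟨a, ha⟩ := Fin.exists_castSucc_eq.2 h'
  obtain ⟨g, hg⟩ := exists_symIncl_of_apply_last
    (σ := σ * swap a.castSucc (Fin.last (m + 1))) (by simp [ha])
  exact ⟨g, a, by rw [← hg, mul_assoc, swap_mul_self, mul_one]⟩

theorem algA_induction {p : Op d (m + 2) → Prop} (lift : ∀ g, p (liftOp m d g))
    (pair : ∀ g a, p (liftOp m d g * pairOp m d a)) (zero : p 0)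
    (add : ∀ x y, p x → p y → p (x + y)) (smul : ∀ (c : ℂ) x, p x → p (c • x))
    {x : Op d (m + 2)} (hx : x ∈ algA m d) : p x := by
  refine Submodule.span_induction ?_ zero (fun x y _ _ => add x y) (fun c x _ => smul c x) hx
  rintro _ ⟨σ, rfl⟩
  by_cases h : σ (Fin.last (m + 1)) = Fin.last (m + 1)
  · obtain ⟨g, rfl⟩ := exists_symIncl_of_apply_last h
    rw [ptOp_symIncl]
    exact lift g
  · obtain ⟨g, a, rfl⟩ := exists_symIncl_mul_swap h
    rw [ptOp_symIncl_mul]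
    exact pair g a

theorem idealM_induction {p : Op d (m + 2) → Prop}
    (pair : ∀ g a, p (liftOp m d g * pairOp m d a)) (zero : p 0)
    (add : ∀ x y, p x → p y → p (x + y)) (smul : ∀ (c : ℂ) x, p x → p (c • x))
    {x : Op d (m + 2)} (hx : x ∈ idealM m d) : p x := by
  refine Submodule.span_induction ?_ zero (fun x y _ _ => add x y) (fun c x _ => smul c x) hx
  rintro _ ⟨σ, h, rfl⟩
  obtain ⟨g, a, rfl⟩ := exists_symIncl_mul_swap h
  rw [ptOp_symIncl_mul]
  exact pair g a

theorem pairOp_mul_liftOp_mem_algA (a : Fin (m + 1)) (g : Perm (Fin (m + 1))) :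
    pairOp m d a * liftOp m d g ∈ algA m d := by
  rw [pairOp, ← ptOp_mul_symIncl]
  exact Submodule.subset_span ⟨_, rfl⟩

/-! ### Unitary matrix representations -/

section Representations

variable {G : Type*} [Group G]

/-- Schur's lemma. -/
theorem eq_smul_one_of_commute {ι : Type*} [Fintype ι] [DecidableEq ι] (φ : G →* Matrix ι ι ℂ)
    (hφ : (matRep φ).IsIrreducible) (X : Matrix ι ι ℂ) (hX : ∀ g, X * φ g = φ g * X) :
    ∃ c : ℂ, X = c • 1 := by
  let f : (matRep φ).IntertwiningMap (matRep φ) :=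
    ⟨X.mulVecLin, fun g => by
      refine LinearMap.ext fun v => ?_
      change X *ᵥ (φ g *ᵥ v) = φ g *ᵥ (X *ᵥ v)
      rw [Matrix.mulVec_mulVec, Matrix.mulVec_mulVec, hX]⟩
  obtain ⟨c, hc⟩ :=
    (Representation.IsIrreducible.algebraMap_intertwiningMap_bijective_of_isAlgClosed).2 f
  refine ⟨c, Matrix.ext_of_mulVec_single fun i => ?_⟩
  have h := congrArg (fun F : (matRep φ).IntertwiningMap (matRep φ) => F (Pi.single i 1)) hc
  rw [Matrix.smul_mulVec, Matrix.one_mulVec]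
  exact h.symm

theorem nonempty_of_isIrreducible {ι : Type*} [Fintype ι] [DecidableEq ι]
    {φ : G →* Matrix ι ι ℂ} (hφ : (matRep φ).IsIrreducible) : Nonempty ι := by
  by_contra h
  rw [not_nonempty_iff] at h
  refine bot_ne_top (α := Subrepresentation (matRep φ)) ?_
  exact Subrepresentation.toSubmodule_injective (Subsingleton.elim _ _)

/-- The average commutes with φ, hence is scalar by Schur's lemma, and its trace determines the
scalar. -/
theorem sum_conj_eq [Fintype G] {ι : Type*} [Fintype ι] [DecidableEq ι] (φ : G →* Matrix ι ι ℂ)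
    (hφ : (matRep φ).IsIrreducible) (X : Matrix ι ι ℂ) :
    ((Fintype.card ι : ℂ) / Fintype.card G) • ∑ g, φ g * X * φ g⁻¹ = X.trace • 1 := by
  have := nonempty_of_isIrreducible hφ
  obtain ⟨c, hc⟩ := eq_smul_one_of_commute φ hφ (∑ g, φ g * X * φ g⁻¹) (by
    intro h
    rw [Finset.sum_mul, Finset.mul_sum]
    refine Fintype.sum_equiv (Equiv.mulLeft h⁻¹) _ _ fun g => ?_
    simp only [Equiv.coe_mulLeft, mul_inv_rev, inv_inv, ← mul_assoc]
    rw [← map_mul, mul_inv_cancel_left, mul_assoc _ (φ g⁻¹), ← map_mul])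
  have htr := congrArg Matrix.trace hc
  rw [Matrix.trace_sum, Matrix.trace_smul, Matrix.trace_one] at htr
  have h1 : ∀ g ∈ Finset.univ, (φ g * X * φ g⁻¹).trace = X.trace := by
    intro g _
    rw [Matrix.trace_mul_comm, ← mul_assoc, ← map_mul, inv_mul_cancel, map_one, one_mul]
  rw [Finset.sum_congr rfl h1, Finset.sum_const, Finset.card_univ, nsmul_eq_mul,
    smul_eq_mul] at htr
  rw [hc, smul_smul]
  congr 1
  have hG : (Fintype.card G : ℂ) ≠ 0 := Nat.cast_ne_zero.2 Fintype.card_ne_zero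
  field_simp
  linear_combination -htr

/-- Schur orthogonality: the entries of `sum_conj_eq` at elementary matrices X. -/
theorem sum_coeff_smul_eq_single [Fintype G] {ι : Type*} [Fintype ι] [DecidableEq ι]
    (φ : G →* Matrix ι ι ℂ) (hφ : (matRep φ).IsIrreducible) (i j : ι) :
    ((Fintype.card ι : ℂ) / Fintype.card G) • ∑ g, φ g⁻¹ j i • φ g = Matrix.single i j 1 := by
  ext k l
  have h := congrFun (congrFun (sum_conj_eq φ hφ (Matrix.single l j 1)) k) i
  have h2 : ∀ g, (φ g * Matrix.single l j (1 : ℂ) * φ g⁻¹) k i = φ g⁻¹ j i * φ g k l := by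
    intro g
    rw [mul_assoc, Matrix.mul_apply, Finset.sum_eq_single l]
    · rw [Matrix.single_mul_apply_same, one_mul, mul_comm]
    · intro b _ hb
      rw [Matrix.single_mul_apply_of_ne _ _ _ _ _ hb, mul_zero]
    · simp
  simp only [Matrix.smul_apply, Matrix.sum_apply, h2] at h
  simp only [Matrix.smul_apply, Matrix.sum_apply, smul_eq_mul] at h ⊢
  rw [h, Matrix.single_apply, Matrix.one_apply]
  by_cases hlj : l = j
  · subst hlj
    simp [eq_comm]
  · simp [Matrix.trace_single_eq_of_ne _ _ _ hlj, Ne.symm hlj]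

theorem exists_orthonormal_columns {ι : Type*} [Fintype ι] [DecidableEq ι]
    (W : Submodule ℂ (ι → ℂ)) :
    ∃ (w : ℕ) (B : Matrix ι (Fin w) ℂ), Bᴴ * B = 1 ∧ LinearMap.range B.mulVecLin = W := by
  let e : EuclideanSpace ℂ ι ≃ₗ[ℂ] (ι → ℂ) := WithLp.linearEquiv 2 ℂ (ι → ℂ)
  let b := stdOrthonormalBasis ℂ (W.comap e.toLinearMap)
  refine ⟨_, Matrix.of fun i k => (b k : EuclideanSpace ℂ ι) i, ?_, ?_⟩
  · ext k l
    have h := orthonormal_iff_ite.1 b.orthonormal k l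
    rw [Submodule.coe_inner, EuclideanSpace.inner_eq_star_dotProduct] at h
    rw [Matrix.one_apply, ← h, dotProduct_comm]
    rfl
  · rw [Matrix.range_mulVecLin]
    have hb := b.toBasis.span_eq
    have := congrArg (Submodule.map (e.toLinearMap ∘ₗ (W.comap e.toLinearMap).subtype)) hb
    rw [Submodule.map_span, Submodule.map_top, LinearMap.range_comp, Submodule.range_subtype,
      Submodule.map_comap_eq_of_surjective e.surjective, ← Set.range_comp] at this
    refine Eq.trans (congrArg _ (congrArg Set.range (funext fun k => ?_))) this
    simp only [Function.comp_apply, OrthonormalBasis.coe_toBasis]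
    rfl

/-- A nonzero vector in a unitary representation has nonzero image under an intertwining map to
some irreducible unitary representation. -/
theorem exists_irreducible_intertwiner {ι : Type*} [Fintype ι] [DecidableEq ι]
    (ρ : G →* Matrix ι ι ℂ) (hρ : ∀ g, (ρ g)ᴴ = ρ g⁻¹) (v : ι → ℂ) (hv : v ≠ 0) :
    ∃ (w : ℕ) (φ : G →* Matrix (Fin w) (Fin w) ℂ) (p : Matrix (Fin w) ι ℂ),
      (∀ g, φ g ∈ Matrix.unitaryGroup (Fin w) ℂ) ∧ (matRep φ).IsIrreducible ∧
      (∀ g, p * ρ g = φ g * p) ∧ p *ᵥ v ≠ 0 := by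
  let O : Submodule ℂ (ι → ℂ) := Submodule.span ℂ (Set.range fun g => ρ g *ᵥ v)
  let S : Set (Submodule ℂ (ι → ℂ)) := {W | W ≤ O ∧ W ≠ ⊥ ∧ ∀ g, ∀ x ∈ W, ρ g *ᵥ x ∈ W}
  have hO : O ∈ S := by
    refine ⟨le_rfl, ?_, fun g => ?_⟩
    · intro h
      have : v ∈ O := Submodule.subset_span ⟨1, by simp⟩
      rw [h] at this
      exact hv this
    · change O ≤ O.comap (ρ g).mulVecLin
      refine Submodule.span_le.2 ?_
      rintro _ ⟨h, rfl⟩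
      refine Submodule.subset_span ⟨g * h, ?_⟩
      simp
  -- A minimal invariant subspace W inside the span O of the orbit of v. Compressing to an
  -- orthonormal basis of W gives φ, and the required map is the adjoint of the inclusion.
  obtain ⟨W, ⟨hWO, hW0, hWinv⟩, hWmin⟩ := WellFounded.has_min
    (wellFounded_lt (α := Submodule ℂ (ι → ℂ))) S ⟨O, hO⟩
  obtain ⟨w, B, hB, hBW⟩ := exists_orthonormal_columns W
  have hBmem : ∀ y, B *ᵥ y ∈ W := fun y => hBW ▸ ⟨y, rfl⟩
  have hBB : ∀ x ∈ W, B *ᵥ (Bᴴ *ᵥ x) = x := by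
    intro x hx
    rw [← hBW] at hx
    obtain ⟨y, rfl⟩ := hx
    rw [Matrix.mulVecLin_apply, Matrix.mulVec_mulVec y Bᴴ B, hB, Matrix.one_mulVec]
  have hρB : ∀ g, ρ g * B = B * (Bᴴ * ρ g * B) := by
    intro g
    refine Matrix.ext_of_mulVec_single fun i => ?_
    have := hBB _ (hWinv g _ (hBmem (Pi.single i 1)))
    rw [← Matrix.mulVec_mulVec, ← this]
    simp only [Matrix.mulVec_mulVec, Matrix.mul_assoc]
  let φ : G →* Matrix (Fin w) (Fin w) ℂ :=
    { toFun g := Bᴴ * ρ g * B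
      map_one' := by simp [hB]
      map_mul' g h := by
        rw [map_mul, Matrix.mul_assoc Bᴴ (ρ g * ρ h), Matrix.mul_assoc (ρ g), hρB h]
        simp only [Matrix.mul_assoc] }
  have hφ : ∀ g, (φ g)ᴴ = φ g⁻¹ := by
    intro g
    change (Bᴴ * ρ g * B)ᴴ = Bᴴ * ρ g⁻¹ * B
    rw [Matrix.conjTranspose_mul, Matrix.conjTranspose_mul, hρ, Matrix.conjTranspose_conjTranspose,
      Matrix.mul_assoc]
  have hp : ∀ g, Bᴴ * ρ g = φ g * Bᴴ := by
    intro g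
    have := congrArg Matrix.conjTranspose (hρB g⁻¹)
    rw [Matrix.conjTranspose_mul, Matrix.conjTranspose_mul, hρ, inv_inv] at this
    rw [this]
    congr 1
    exact (hφ _).trans (by rw [inv_inv])
  refine ⟨w, φ, Bᴴ, fun g => ?_, ?_, hp, ?_⟩
  · rw [Matrix.mem_unitaryGroup_iff, Matrix.star_eq_conjTranspose, hφ, ← map_mul, mul_inv_cancel,
      map_one]
  · have hB0 : ∀ y, B *ᵥ y = 0 → y = 0 := by
      intro y hy
      rw [← Matrix.one_mulVec y, ← hB, ← Matrix.mulVec_mulVec, hy, Matrix.mulVec_zero]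
    have hnt : Nontrivial (Subrepresentation (matRep φ)) := by
      refine ⟨⊥, ⊤, fun h => hW0 ?_⟩
      have h2 : (⊥ : Submodule ℂ (Fin w → ℂ)) = ⊤ :=
        congrArg Subrepresentation.toSubmodule h
      rw [← hBW, LinearMap.range_eq_map, ← h2, Submodule.map_bot]
    refine ⟨fun T => or_iff_not_imp_left.2 fun hT => ?_⟩
    have hTS : T.toSubmodule.map B.mulVecLin ∈ S := by
      refine ⟨?_, ?_, ?_⟩
      · rintro _ ⟨y, -, rfl⟩
        exact hWO (hBmem y)
      · intro h
        apply hT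
        apply Subrepresentation.toSubmodule_injective
        refine (Submodule.eq_bot_iff _).2 fun y hy => hB0 y ?_
        have : B.mulVecLin y ∈ T.toSubmodule.map B.mulVecLin := ⟨y, hy, rfl⟩
        rw [h] at this
        exact this
      · rintro g _ ⟨y, hy, rfl⟩
        refine ⟨_, T.apply_mem_toSubmodule g hy, ?_⟩
        rw [Matrix.mulVecLin_apply, Matrix.mulVecLin_apply, matRep_apply, Matrix.mulVec_mulVec,
          Matrix.mulVec_mulVec, hρB]
        rfl
    have hTW : T.toSubmodule.map B.mulVecLin = W := by
      by_contra hne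
      refine hWmin _ hTS (lt_of_le_of_ne ?_ hne)
      rintro _ ⟨y, -, rfl⟩
      exact hBmem y
    apply Subrepresentation.toSubmodule_injective
    refine (Submodule.eq_top_iff'.2 fun y => ?_)
    have := hBmem y
    rw [← hTW] at this
    obtain ⟨z, hz, hzy⟩ := this
    have : z - y = 0 := hB0 _ (by
      rw [Matrix.mulVec_sub]
      exact sub_eq_zero.2 hzy)
    rwa [← sub_eq_zero.1 this]
  · intro h
    -- If Bᴴ kills v it kills all of O, hence W; but B Bᴴ is the identity on W.
    have hOker : O ≤ LinearMap.ker (Bᴴ).mulVecLin := by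
      refine Submodule.span_le.2 ?_
      rintro _ ⟨g, rfl⟩
      change Bᴴ *ᵥ (ρ g *ᵥ v) = 0
      rw [Matrix.mulVec_mulVec, hp, ← Matrix.mulVec_mulVec, h, Matrix.mulVec_zero]
    apply hW0
    refine (Submodule.eq_bot_iff _).2 fun x hx => ?_
    have : Bᴴ *ᵥ x = 0 := hOker (hWO hx)
    rw [← hBB x hx, this, Matrix.mulVec_zero]

end Representations

/-! ### The elements `u^{ab}_{ij}(α)` -/

theorem hat_mul_left {G H κ : Type*} [Group G] [Group H] [Fintype κ] [DecidableEq κ] (j : H →* G)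
    (hj : Function.Injective j) (φ : H →* Matrix κ κ ℂ) {k : G} (hk : k ∈ j.range) (g : G) :
    hat j φ (k * g) = hat j φ k * hat j φ g := by
  by_cases hg : g ∈ j.range
  · exact hat_mul j hj φ k hg
  · have : k * g ∉ j.range := fun h => hg ((Subgroup.mul_mem_cancel_left _ hk).1 h)
    rw [hat_of_notMem j φ hg, hat_of_notMem j φ this, mul_zero]

theorem liftOp_swap_mul_self (m d : ℕ) (a b : Fin (m + 1)) :
    liftOp m d (swap a b) * liftOp m d (swap a b) = 1 := by
  rw [← map_mul, swap_mul_self, map_one]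

namespace UnitaryIrrep

variable {m : ℕ} (α : UnitaryIrrep m) (d : ℕ)

/-- The matrix units `(w^α / (n-2)!) ∑_σ φ^α_{ji}(σ⁻¹) V(σ)` of the algebra of operators spanned by
`V(σ)`, `σ ∈ S(n-2)`. -/
def unitOp (i j : Fin α.dim) : Op d (m + 2) :=
  ((α.dim : ℂ) / (m.factorial : ℂ)) •
    ∑ σ : Perm (Fin m), α.mat σ⁻¹ j i • liftOp m d (symIncl m σ)

theorem mat_conjTranspose (σ : Perm (Fin m)) : (α.mat σ)ᴴ = α.mat σ⁻¹ := by
  have h := Matrix.mem_unitaryGroup_iff'.1 (α.unitary σ)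
  calc (α.mat σ)ᴴ = (star (α.mat σ) * α.mat σ) * α.mat σ⁻¹ := by
        rw [mul_assoc, ← map_mul, mul_inv_cancel, map_one, mul_one]
        rfl
    _ = α.mat σ⁻¹ := by rw [h, one_mul]

theorem sum_coeff_smul_mat (i j : Fin α.dim) :
    ((α.dim : ℂ) / (m.factorial : ℂ)) • ∑ σ : Perm (Fin m), α.mat σ⁻¹ j i • α.mat σ =
      Matrix.single i j 1 := by
  have h := sum_coeff_smul_eq_single α.mat α.irreducible i j
  rwa [Fintype.card_fin, Fintype.card_perm, Fintype.card_fin] at h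

theorem mul_unitOp (p : Matrix (Fin α.dim) (Fin (m + 2) → Fin d) ℂ)
    (hp : ∀ σ, p * liftOp m d (symIncl m σ) = α.mat σ * p) (i j : Fin α.dim) :
    p * α.unitOp d i j = Matrix.single i j (1 : ℂ) * p := by
  rw [← α.sum_coeff_smul_mat, unitOp, Matrix.mul_smul, Matrix.mul_sum, Matrix.smul_mul,
    Matrix.sum_mul]
  simp only [Matrix.mul_smul, Matrix.smul_mul, hp]

theorem unitOp_mul (f : Matrix (Fin (m + 2) → Fin d) (Fin α.dim) ℂ)
    (hf : ∀ σ, liftOp m d (symIncl m σ) * f = f * α.mat σ) (i j : Fin α.dim) :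
    α.unitOp d i j * f = f * Matrix.single i j (1 : ℂ) := by
  rw [← α.sum_coeff_smul_mat, unitOp, Matrix.mul_smul, Matrix.mul_sum, Matrix.smul_mul,
    Matrix.sum_mul]
  simp only [Matrix.mul_smul, Matrix.smul_mul, hf]

theorem unitOp_mul_liftOp (τ : Perm (Fin m)) (i j : Fin α.dim) :
    α.unitOp d i j * liftOp m d (symIncl m τ) = ∑ k, α.mat τ j k • α.unitOp d i k := by
  have h : ∀ k, α.mat τ j k • α.unitOp d i k = ((α.dim : ℂ) / (m.factorial : ℂ)) •
      ∑ σ : Perm (Fin m), (α.mat τ j k * α.mat σ⁻¹ k i) • liftOp m d (symIncl m σ) := by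
    intro k
    rw [unitOp, smul_comm, Finset.smul_sum]
    simp only [smul_smul]
  rw [Finset.sum_congr rfl fun k _ => h k, ← Finset.smul_sum, Finset.sum_comm, unitOp,
    Matrix.smul_mul, Matrix.sum_mul]
  congr 1
  refine Fintype.sum_equiv (Equiv.mulRight τ) _ _ fun σ => ?_
  rw [← Finset.sum_smul, ← Matrix.mul_apply, ← map_mul, Matrix.smul_mul, ← map_mul, ← map_mul,
    Equiv.coe_mulRight, mul_inv_rev, mul_inv_cancel_left]

theorem unitOp_conjTranspose (i j : Fin α.dim) : (α.unitOp d i j)ᴴ = α.unitOp d j i := by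
  rw [unitOp, unitOp, Matrix.conjTranspose_smul, Matrix.conjTranspose_sum]
  congr 1
  · simp
  · refine Fintype.sum_equiv (Equiv.inv _) _ _ fun σ => ?_
    rw [Matrix.conjTranspose_smul, liftOp_conjTranspose, ← Matrix.conjTranspose_apply,
      mat_conjTranspose, ← map_inv]
    rfl

theorem liftOp_mul_unitOp (τ : Perm (Fin m)) (i j : Fin α.dim) :
    liftOp m d (symIncl m τ) * α.unitOp d i j = ∑ k, α.mat τ k i • α.unitOp d k j := by
  rw [← Matrix.conjTranspose_conjTranspose (_ * _), Matrix.conjTranspose_mul,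
    unitOp_conjTranspose, liftOp_conjTranspose, ← map_inv, unitOp_mul_liftOp,
    Matrix.conjTranspose_sum]
  refine Finset.sum_congr rfl fun k _ => ?_
  rw [Matrix.conjTranspose_smul, unitOp_conjTranspose, ← Matrix.conjTranspose_apply,
    mat_conjTranspose, inv_inv]

theorem liftOp_mul_unitOp_of_fix {g : Perm (Fin (m + 1))} (hg : g (Fin.last m) = Fin.last m)
    (i j : Fin α.dim) :
    liftOp m d g * α.unitOp d i j = ∑ k, hat (symIncl m) α.mat g k i • α.unitOp d k j := by
  obtain ⟨τ, rfl⟩ := (mem_range_symIncl _ _).2 hg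
  simp only [liftOp_mul_unitOp, hat_apply _ (symIncl_injective m)]

/-- Each V(σ) acts on the units from the left through φ^α(σ), so Schur orthogonality collapses the
sum over σ. -/
theorem unitOp_mul_unitOp (i j k l : Fin α.dim) :
    α.unitOp d i j * α.unitOp d k l = if j = k then α.unitOp d i l else 0 := by
  rw [unitOp, Matrix.smul_mul, Matrix.sum_mul]
  simp only [Matrix.smul_mul, liftOp_mul_unitOp, Finset.smul_sum]
  rw [Finset.sum_comm]
  have h : ∀ x : Fin α.dim, ∑ σ : Perm (Fin m), ((α.dim : ℂ) / (m.factorial : ℂ)) •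
      α.mat σ⁻¹ j i • α.mat σ x k • α.unitOp d x l =
      (Matrix.single i j (1 : ℂ)) x k • α.unitOp d x l := by
    intro x
    rw [← α.sum_coeff_smul_mat, Matrix.smul_apply, Matrix.sum_apply, smul_assoc, Finset.sum_smul,
      Finset.smul_sum]
    simp only [Matrix.smul_apply, smul_assoc]
  simp only [h, Matrix.single_apply, ite_smul, one_smul, zero_smul]
  by_cases hjk : j = k <;> simp [hjk]

theorem pairOp_last_mul_unitOp (i j : Fin α.dim) :
    pairOp m d (Fin.last m) * α.unitOp d i j = α.unitOp d i j * pairOp m d (Fin.last m) := by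
  simp only [unitOp, Matrix.smul_mul, Matrix.mul_smul, Matrix.sum_mul, Matrix.mul_sum]
  simp only [liftOp_mul_pairOp, symIncl_last]

/-- This symmetric form, with all of S(n-2) and the pairing at n-1 in the middle, makes adjoints and
products computable. -/
theorem u_eq (a b : Fin (m + 1)) (i k : Fin α.dim) :
    α.u d a b i k = liftOp m d (swap a (Fin.last m)) * pairOp m d (Fin.last m) *
      α.unitOp d i k * liftOp m d (swap b (Fin.last m)) := by
  rw [liftOp_mul_pairOp, swap_apply_right]
  simp only [u, unitOp, pairOp, Matrix.mul_smul, Matrix.smul_mul, Matrix.mul_sum, Matrix.sum_mul,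
    mul_assoc]
  congr 1
  refine Finset.sum_congr rfl fun σ _ => ?_
  rw [← map_mul, ← map_mul]
  rfl

theorem u_mem_algA (a b : Fin (m + 1)) (i k : Fin α.dim) : α.u d a b i k ∈ algA m d := by
  rw [u, Matrix.mul_sum]
  refine Submodule.smul_mem _ _ (Submodule.sum_mem _ fun σ _ => ?_)
  rw [Matrix.mul_smul]
  exact Submodule.smul_mem _ _ (pairOp_mul_liftOp_mem_algA _ _)

theorem u_conjTranspose (a b : Fin (m + 1)) (i k : Fin α.dim) :
    (α.u d a b i k)ᴴ = α.u d b a k i := by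
  simp only [u_eq, Matrix.conjTranspose_mul, liftOp_conjTranspose, swap_inv, pairOp_conjTranspose,
    unitOp_conjTranspose, mul_assoc]
  rw [← mul_assoc (α.unitOp d k i), ← pairOp_last_mul_unitOp, mul_assoc]

/-- Factor g (a n-1) = (g(a) n-1) h with h ∈ S(n-2); h passes through the pairing at n-1 and acts on
the matrix unit. -/
theorem liftOp_mul_u_apply (g : Perm (Fin (m + 1))) (a b : Fin (m + 1)) (i j : Fin α.dim) :
    liftOp m d g * α.u d a b i j =
      ∑ k, hat (symIncl m) α.mat (swap (g a) (Fin.last m) * g * swap a (Fin.last m)) k i •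
        α.u d (g a) b k j := by
  have hfix : (swap (g a) (Fin.last m) * g * swap a (Fin.last m)) (Fin.last m) = Fin.last m := by
    simp
  have hg : g * swap a (Fin.last m) = swap (g a) (Fin.last m) *
      (swap (g a) (Fin.last m) * g * swap a (Fin.last m)) := by
    simp only [← mul_assoc, swap_mul_self, one_mul]
  calc liftOp m d g * α.u d a b i j
      = liftOp m d (g * swap a (Fin.last m)) * pairOp m d (Fin.last m) * α.unitOp d i j *
          liftOp m d (swap b (Fin.last m)) := by
        simp only [u_eq, map_mul, mul_assoc]
    _ = liftOp m d (swap (g a) (Fin.last m)) * pairOp m d (Fin.last m) *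
          (liftOp m d (swap (g a) (Fin.last m) * g * swap a (Fin.last m)) * α.unitOp d i j) *
          liftOp m d (swap b (Fin.last m)) := by
        conv_lhs => rw [hg, map_mul, mul_assoc (liftOp m d (swap (g a) (Fin.last m))),
          liftOp_mul_pairOp _ (Fin.last m), hfix]
        simp only [mul_assoc]
    _ = _ := by
        rw [liftOp_mul_unitOp_of_fix _ _ hfix]
        simp only [Matrix.mul_sum, Matrix.sum_mul, Matrix.mul_smul, Matrix.smul_mul, u_eq]

theorem pairOp_mul_u_apply (c a b : Fin (m + 1)) (i j : Fin α.dim) :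
    pairOp m d c * α.u d a b i j = ∑ k, α.Q d (c, k) (a, i) • α.u d c b k j := by
  have h1 : α.u d a b i j = pairOp m d a * (liftOp m d (swap a (Fin.last m)) *
      α.unitOp d i j * liftOp m d (swap b (Fin.last m))) := by
    rw [u_eq, liftOp_mul_pairOp, swap_apply_right]
    simp only [mul_assoc]
  have h2 : pairOp m d c * α.u d a b i j =
      (if c = a then (d : ℂ) else 1) • (liftOp m d (swap c a) * α.u d a b i j) := by
    rw [h1, ← mul_assoc, pairOp_mul_pairOp, Matrix.smul_mul, mul_assoc]
  rw [h2, liftOp_mul_u_apply, swap_apply_right, Finset.smul_sum]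
  simp only [smul_smul]
  rfl

/-- The matrix Q enters as the sandwich matrix of a Munn algebra: P_b acting on the second factor
produces Q, and the matrix units then pick out one entry. -/
theorem u_mul_u (a b c e : Fin (m + 1)) (i j k l : Fin α.dim) :
    α.u d a b i j * α.u d c e k l = α.Q d (b, j) (c, k) • α.u d a e i l := by
  have h1 : α.u d a b i j = liftOp m d (swap a (Fin.last m)) * α.unitOp d i j *
      liftOp m d (swap b (Fin.last m)) * pairOp m d b := by
    rw [u_eq, mul_assoc (liftOp m d (swap a (Fin.last m))), pairOp_last_mul_unitOp,
      mul_assoc _ (liftOp m d (swap b (Fin.last m))), liftOp_mul_pairOp, swap_apply_left]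
    simp only [mul_assoc]
  have h2 : ∀ x, liftOp m d (swap a (Fin.last m)) * α.unitOp d i j *
      liftOp m d (swap b (Fin.last m)) * α.u d b e x l =
      if j = x then α.u d a e i l else 0 := by
    intro x
    calc _ = liftOp m d (swap a (Fin.last m)) * α.unitOp d i j *
          (liftOp m d (swap b (Fin.last m)) * liftOp m d (swap b (Fin.last m))) *
          pairOp m d (Fin.last m) * α.unitOp d x l * liftOp m d (swap e (Fin.last m)) := by
          simp only [u_eq, mul_assoc]
      _ = liftOp m d (swap a (Fin.last m)) * pairOp m d (Fin.last m) *
          (α.unitOp d i j * α.unitOp d x l) * liftOp m d (swap e (Fin.last m)) := by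
          rw [liftOp_swap_mul_self, mul_one, mul_assoc (liftOp m d (swap a (Fin.last m))),
            ← pairOp_last_mul_unitOp]
          simp only [mul_assoc]
      _ = _ := by
          rw [unitOp_mul_unitOp]
          split_ifs
          · rw [u_eq]
          · simp
  rw [h1, mul_assoc, pairOp_mul_u_apply, Matrix.mul_sum]
  simp only [Matrix.mul_smul, h2]
  simp

/-! ### Linear combinations of the `u^{ab}_{ij}(α)` -/

/-- The element `∑ X_{ai,bj} u^{ab}_{ij}(α)`. -/
def uMap : Matrix (Fin (m + 1) × Fin α.dim) (Fin (m + 1) × Fin α.dim) ℂ →ₗ[ℂ] Op d (m + 2) where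
  toFun X := ∑ p, ∑ q, X p q • α.u d p.1 q.1 p.2 q.2
  map_add' X Y := by simp only [Matrix.add_apply, add_smul, Finset.sum_add_distrib]
  map_smul' c X := by
    simp only [Matrix.smul_apply, smul_assoc, Finset.smul_sum, RingHom.id_apply]

theorem uMap_apply (X : Matrix (Fin (m + 1) × Fin α.dim) (Fin (m + 1) × Fin α.dim) ℂ) :
    α.uMap d X = ∑ p, ∑ q, X p q • α.u d p.1 q.1 p.2 q.2 := rfl

theorem uMap_single (p q : Fin (m + 1) × Fin α.dim) :
    α.uMap d (Matrix.single p q 1) = α.u d p.1 q.1 p.2 q.2 := by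
  rw [uMap_apply, Finset.sum_eq_single p, Finset.sum_eq_single q]
  · simp
  · intro r _ hr
    simp [hr.symm]
  · simp
  · intro r _ hr
    simp [hr.symm]
  · simp

theorem mem_idealU_iff {x : Op d (m + 2)} : x ∈ α.idealU d ↔ ∃ X, α.uMap d X = x := by
  have h : α.idealU d = LinearMap.range (α.uMap d) := by
    refine le_antisymm (Submodule.span_le.2 ?_) ?_
    · rintro _ ⟨a, b, i, k, rfl⟩
      exact ⟨_, α.uMap_single d (a, i) (b, k)⟩
    · rintro _ ⟨X, rfl⟩
      rw [uMap_apply]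
      exact Submodule.sum_mem _ fun p _ => Submodule.sum_mem _ fun q _ =>
        Submodule.smul_mem _ _ (Submodule.subset_span ⟨_, _, _, _, rfl⟩)
  rw [h]
  rfl

theorem uMap_mem_algA (X : Matrix (Fin (m + 1) × Fin α.dim) (Fin (m + 1) × Fin α.dim) ℂ) :
    α.uMap d X ∈ algA m d := by
  rw [uMap_apply]
  exact Submodule.sum_mem _ fun p _ => Submodule.sum_mem _ fun q _ =>
    Submodule.smul_mem _ _ (α.u_mem_algA d _ _ _ _)

theorem uMap_conjTranspose (X : Matrix (Fin (m + 1) × Fin α.dim) (Fin (m + 1) × Fin α.dim) ℂ) :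
    (α.uMap d X)ᴴ = α.uMap d Xᴴ := by
  rw [uMap_apply, uMap_apply, Finset.sum_comm, Matrix.conjTranspose_sum]
  refine Finset.sum_congr rfl fun p _ => ?_
  rw [Matrix.conjTranspose_sum]
  refine Finset.sum_congr rfl fun q _ => ?_
  rw [Matrix.conjTranspose_smul, u_conjTranspose, Matrix.conjTranspose_apply]

theorem mul_uMap (z : Op d (m + 2))
    (ρ : Matrix (Fin (m + 1) × Fin α.dim) (Fin (m + 1) × Fin α.dim) ℂ)
    (h : ∀ p q : Fin (m + 1) × Fin α.dim,
      z * α.u d p.1 q.1 p.2 q.2 = ∑ r, ρ r p • α.u d r.1 q.1 r.2 q.2)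
    (X : Matrix (Fin (m + 1) × Fin α.dim) (Fin (m + 1) × Fin α.dim) ℂ) :
    z * α.uMap d X = α.uMap d (ρ * X) := by
  simp only [uMap_apply, Matrix.mul_sum, Matrix.mul_smul, h, Finset.smul_sum, smul_smul,
    Matrix.mul_apply, Finset.sum_smul]
  calc ∑ p, ∑ q, ∑ r, (X p q * ρ r p) • α.u d r.1 q.1 r.2 q.2
      = ∑ p, ∑ r, ∑ q, (X p q * ρ r p) • α.u d r.1 q.1 r.2 q.2 :=
        Finset.sum_congr rfl fun p _ => Finset.sum_comm
    _ = ∑ r, ∑ p, ∑ q, (X p q * ρ r p) • α.u d r.1 q.1 r.2 q.2 := Finset.sum_comm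
    _ = ∑ r, ∑ q, ∑ p, (X p q * ρ r p) • α.u d r.1 q.1 r.2 q.2 :=
        Finset.sum_congr rfl fun r _ => Finset.sum_comm
    _ = _ := by simp only [mul_comm]

theorem uMap_mul_uMap (Y X : Matrix (Fin (m + 1) × Fin α.dim) (Fin (m + 1) × Fin α.dim) ℂ) :
    α.uMap d Y * α.uMap d X = α.uMap d (Y * α.Q d * X) := by
  refine α.mul_uMap d _ _ (fun p q => ?_) X
  rw [uMap_apply, Matrix.sum_mul]
  refine Finset.sum_congr rfl fun r _ => ?_
  rw [Matrix.sum_mul, Matrix.mul_apply, Finset.sum_smul]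
  refine Finset.sum_congr rfl fun s _ => ?_
  rw [Matrix.smul_mul, u_mul_u, smul_smul]

theorem liftOp_mul_uMap (g : Perm (Fin (m + 1)))
    (X : Matrix (Fin (m + 1) × Fin α.dim) (Fin (m + 1) × Fin α.dim) ℂ) :
    liftOp m d g * α.uMap d X = α.uMap d (α.ind g * X) := by
  refine α.mul_uMap d _ _ (fun p q => ?_) X
  rw [liftOp_mul_u_apply, Fintype.sum_prod_type, Finset.sum_eq_single (g p.1)]
  · rfl
  · intro c _ hc
    refine Finset.sum_eq_zero fun k _ => ?_
    have : (cosetRep m c)⁻¹ * g * cosetRep m p.1 ∉ (symIncl m).range := by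
      rw [mem_range_symIncl, Perm.mul_apply, Perm.mul_apply, Perm.inv_eq_iff_eq, cosetRep,
        cosetRep, swap_apply_right, swap_apply_right]
      exact fun h => hc h.symm
    have h0 : α.ind g (c, k) p = 0 := by
      change hat (symIncl m) α.mat ((cosetRep m c)⁻¹ * g * cosetRep m p.1) k p.2 = 0
      rw [hat_of_notMem _ _ this, Matrix.zero_apply]
    rw [h0, zero_smul]
  · simp

theorem pairOp_mul_uMap (c : Fin (m + 1))
    (X : Matrix (Fin (m + 1) × Fin α.dim) (Fin (m + 1) × Fin α.dim) ℂ) :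
    pairOp m d c * α.uMap d X =
      α.uMap d (Matrix.diagonal (fun p => if p.1 = c then 1 else 0) * α.Q d * X) := by
  refine α.mul_uMap d _ _ (fun p q => ?_) X
  rw [pairOp_mul_u_apply, Fintype.sum_prod_type, Finset.sum_eq_single c]
  · simp [Matrix.diagonal_mul]
  · intro b _ hb
    simp [Matrix.diagonal_mul, hb]
  · simp

theorem exists_mul_uMap {z : Op d (m + 2)} (hz : z ∈ algA m d) :
    ∃ ρ : Matrix (Fin (m + 1) × Fin α.dim) (Fin (m + 1) × Fin α.dim) ℂ,
      ∀ X, z * α.uMap d X = α.uMap d (ρ * X) := by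
  refine algA_induction (p := fun z => ∃ ρ : Matrix _ _ ℂ, ∀ X, z * α.uMap d X =
    α.uMap d (ρ * X)) ?_ ?_ ?_ ?_ ?_ hz
  · exact fun g => ⟨_, α.liftOp_mul_uMap d g⟩
  · intro g a
    refine ⟨α.ind g * (Matrix.diagonal (fun p => if p.1 = a then 1 else 0) * α.Q d), fun X => ?_⟩
    rw [mul_assoc, pairOp_mul_uMap, liftOp_mul_uMap, mul_assoc (α.ind g)]
  · exact ⟨0, fun X => by simp⟩
  · rintro x y ⟨ρ, hρ⟩ ⟨ρ', hρ'⟩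
    exact ⟨ρ + ρ', fun X => by rw [add_mul, hρ, hρ', add_mul, map_add]⟩
  · rintro c x ⟨ρ, hρ⟩
    exact ⟨c • ρ, fun X => by rw [Matrix.smul_mul, hρ, Matrix.smul_mul, map_smul]⟩

/-! ### Q(α) commutes with the induced representation -/

theorem ind_apply (g : Perm (Fin (m + 1))) (p q : Fin (m + 1) × Fin α.dim) :
    α.ind g p q = hat (symIncl m) α.mat
      (swap p.1 (Fin.last m) * g * swap q.1 (Fin.last m)) p.2 q.2 := by
  change hat (symIncl m) α.mat ((cosetRep m p.1)⁻¹ * g * cosetRep m q.1) p.2 q.2 = _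
  rw [cosetRep, cosetRep, swap_inv]

theorem ind_mul_Q (g : Perm (Fin (m + 1))) : α.ind g * α.Q d = α.Q d * α.ind g := by
  have hq : ∀ a b : Fin (m + 1),
      swap a (Fin.last m) * swap a b * swap b (Fin.last m) ∈ (symIncl m).range := by
    intro a b
    rw [mem_range_symIncl]
    simp
  ext ⟨a, i⟩ ⟨c, k⟩
  rw [Matrix.mul_apply, Matrix.mul_apply, Fintype.sum_prod_type, Fintype.sum_prod_type]
  have hl : ∀ b, ∑ j, α.ind g (a, i) (b, j) * α.Q d (b, j) (c, k) = (if b = c then (d : ℂ) else 1) *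
      hat (symIncl m) α.mat (swap a (Fin.last m) * g * (swap b c * swap c (Fin.last m))) i k := by
    intro b
    have : swap a (Fin.last m) * g * (swap b c * swap c (Fin.last m)) =
        (swap a (Fin.last m) * g * swap b (Fin.last m)) *
        (swap b (Fin.last m) * swap b c * swap c (Fin.last m)) := by
      simp [mul_assoc]
    rw [this, hat_mul _ (symIncl_injective m) _ _ (hq b c), Matrix.mul_apply, Finset.mul_sum]
    refine Finset.sum_congr rfl fun j _ => ?_
    rw [ind_apply, Q, Matrix.of_apply]
    ring
  have hr : ∀ b, ∑ j, α.Q d (a, i) (b, j) * α.ind g (b, j) (c, k) = (if a = b then (d : ℂ) else 1) *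
      hat (symIncl m) α.mat (swap a (Fin.last m) * (swap a b * g) * swap c (Fin.last m)) i k := by
    intro b
    have : swap a (Fin.last m) * (swap a b * g) * swap c (Fin.last m) =
        (swap a (Fin.last m) * swap a b * swap b (Fin.last m)) *
        (swap b (Fin.last m) * g * swap c (Fin.last m)) := by
      simp [mul_assoc]
    rw [this, hat_mul_left _ (symIncl_injective m) _ (hq a b), Matrix.mul_apply, Finset.mul_sum]
    refine Finset.sum_congr rfl fun j _ => ?_
    rw [ind_apply, Q, Matrix.of_apply]
    ring
  simp only [hl, hr]
  -- On each side only one b puts the permutation in S(n-2); the two surviving terms agree because g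
  -- (g⁻¹a c) = (a gc) g.
  rw [Finset.sum_eq_single (g⁻¹ a), Finset.sum_eq_single (g c)]
  · have h1 : (g⁻¹ a = c) = (a = g c) := propext Perm.inv_eq_iff_eq
    have h2 : swap a (Fin.last m) * g * (swap (g⁻¹ a) c * swap c (Fin.last m)) =
        swap a (Fin.last m) * (swap a (g c) * g) * swap c (Fin.last m) := by
      have := mul_swap_eq_swap_mul g (g⁻¹ a) c
      rw [← Perm.mul_apply, mul_inv_cancel, Perm.one_apply] at this
      rw [← this]
      simp only [mul_assoc]
    simp only [h1, h2]
  · intro b _ hb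
    rw [hat_of_notMem, Matrix.zero_apply, mul_zero]
    rw [mem_range_symIncl]
    simp only [Perm.mul_apply, swap_apply_right]
    rw [swap_apply_eq_iff, swap_apply_right, swap_apply_eq_iff, swap_apply_left]
    exact fun h => hb h.symm
  · simp
  · intro b _ hb
    rw [hat_of_notMem, Matrix.zero_apply, mul_zero]
    rw [mem_range_symIncl]
    simp only [Perm.mul_apply, swap_apply_right]
    rw [swap_apply_eq_iff, swap_apply_right]
    rintro rfl
    simp at hb
  · simp

end UnitaryIrrep

/-! ### Paired vectors -/

section Paired

variable {m d : ℕ}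

/-- A tensor of the form `y ⊗ ∑_s e_s ⊗ e_s`, with the maximally entangled vector in the last two
factors. -/
structure IsPaired (f : (Fin (m + 2) → Fin d) → ℂ) : Prop where
  eq_zero : ∀ z, z (Fin.last m).castSucc ≠ z (Fin.last (m + 1)) → f z = 0
  pairUpdate_eq : ∀ z s, z (Fin.last m).castSucc = z (Fin.last (m + 1)) →
    f (pairUpdate (Fin.last m) z s) = f z

theorem IsPaired.mulVec {κ : Type*} [Fintype κ] {F : Matrix (Fin (m + 2) → Fin d) κ ℂ}
    (hF : ∀ i, IsPaired fun z => F z i) (v : κ → ℂ) : IsPaired (F *ᵥ v) where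
  eq_zero z hz := Finset.sum_eq_zero fun i _ =>
    mul_eq_zero_of_left ((hF i).eq_zero z hz) _
  pairUpdate_eq z s hz := Finset.sum_congr rfl fun i _ =>
    congrArg (· * v i) ((hF i).pairUpdate_eq z s hz)

theorem pairOp_mul_of_isPaired {κ : Type*} {F : Matrix (Fin (m + 2) → Fin d) κ ℂ}
    (hF : ∀ i, IsPaired fun z => F z i) :
    pairOp m d (Fin.last m) * F = (d : ℂ) • F := by
  ext z i
  rw [pairOp_mul_apply, Matrix.smul_apply, smul_eq_mul]
  split_ifs with hz
  · rw [Finset.sum_congr rfl fun s _ => (hF i).pairUpdate_eq z s hz, Finset.sum_const,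
      Finset.card_univ, Fintype.card_fin, nsmul_eq_mul]
  · rw [(hF i).eq_zero z hz, mul_zero]

/-- Compute P V(a n-1) V(b n-1) P as V(a n-1) P_a P_b V(b n-1), apply it to F, and cancel the d
coming from the right-hand P. The coefficients are those of Q, which ties Q to actual tensors. -/
theorem pairOp_mul_liftOp_mul {κ : Type*} (hd : 1 ≤ d) {F : Matrix (Fin (m + 2) → Fin d) κ ℂ}
    (hF : pairOp m d (Fin.last m) * F = (d : ℂ) • F) (a b : Fin (m + 1)) :
    pairOp m d (Fin.last m) * (liftOp m d (swap a (Fin.last m)) *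
      (liftOp m d (swap b (Fin.last m)) * F)) =
    (if a = b then (d : ℂ) else 1) •
      (liftOp m d (swap a (Fin.last m) * swap a b * swap b (Fin.last m)) * F) := by
  have hd0 : (d : ℂ) ≠ 0 := Nat.cast_ne_zero.2 (by omega)
  have h1 : pairOp m d (Fin.last m) * liftOp m d (swap a (Fin.last m)) =
      liftOp m d (swap a (Fin.last m)) * pairOp m d a := by
    rw [liftOp_mul_pairOp, swap_apply_left]
  have h2 : liftOp m d (swap b (Fin.last m)) * pairOp m d (Fin.last m) =
      pairOp m d b * liftOp m d (swap b (Fin.last m)) := by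
    rw [liftOp_mul_pairOp, swap_apply_right]
  have h3 : pairOp m d (Fin.last m) * liftOp m d (swap a (Fin.last m)) *
      (liftOp m d (swap b (Fin.last m)) * pairOp m d (Fin.last m)) =
      (if a = b then (d : ℂ) else 1) •
      (liftOp m d (swap a (Fin.last m) * swap a b * swap b (Fin.last m)) *
        pairOp m d (Fin.last m)) := by
    rw [h1, h2, mul_assoc, ← mul_assoc (pairOp m d a), pairOp_mul_pairOp, Matrix.smul_mul,
      Matrix.mul_smul, mul_assoc (liftOp m d (swap a b)), ← h2, map_mul, map_mul]
    simp only [mul_assoc]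
  have h4 := congrArg (fun X => X * F) h3
  simp only [Matrix.mul_assoc, hF, Matrix.smul_mul, Matrix.mul_smul] at h4
  rw [smul_comm _ (d : ℂ)] at h4
  exact smul_right_injective _ hd0 h4

theorem pairUpdate_comp_symIncl (σ : Perm (Fin m)) (z : Fin (m + 2) → Fin d) (r s : Fin d) :
    Function.update (Function.update z (Fin.last m).castSucc r) (Fin.last (m + 1)) s ∘
      ⇑(symIncl (m + 1) (symIncl m σ)) =
    Function.update (Function.update (z ∘ ⇑(symIncl (m + 1) (symIncl m σ)))
      (Fin.last m).castSucc r) (Fin.last (m + 1)) s := by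
  rw [update_comp_symIncl]
  congr 1
  ext i
  refine congrArg _ (Fin.lastCases ?_ (fun i => Fin.lastCases ?_ (fun i => ?_) i) i)
  · simp [symIncl_last, (Fin.castSucc_lt_last _).ne']
  · simp [symIncl_last, symIncl_castSucc]
  · simp [symIncl_castSucc, (Fin.castSucc_lt_last _).ne]

end Paired

/-! ### Occurrence of φ^α and linear relations among the u^{ab}_{ij}(α) -/

namespace UnitaryIrrep

variable {m : ℕ} (α : UnitaryIrrep m) {d : ℕ}

theorem occurs_iff : α.Occurs d ↔ ∃ F : Matrix (Fin (m + 2) → Fin d) (Fin α.dim) ℂ, F ≠ 0 ∧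
    ∀ σ, liftOp m d (symIncl m σ) * F = F * α.mat σ := by
  constructor
  · rintro ⟨f, hf⟩
    have hF : ∀ v, LinearMap.toMatrix' f.toLinearMap *ᵥ v = f v := fun v =>
      LinearMap.toMatrix'_mulVec f.toLinearMap v
    refine ⟨LinearMap.toMatrix' f.toLinearMap, fun h => hf ?_, fun σ => ?_⟩
    · refine Representation.IntertwiningMap.ext ?_
      exact (LinearMap.toMatrix'.map_eq_zero_iff).1 h
    · refine Matrix.ext_of_mulVec_single fun i => ?_
      rw [← Matrix.mulVec_mulVec, ← Matrix.mulVec_mulVec, hF, hF]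
      exact (Representation.IntertwiningMap.isIntertwining _ _ f σ (Pi.single i 1)).symm
  · rintro ⟨F, hF, h⟩
    refine ⟨⟨F.mulVecLin, fun σ => LinearMap.ext fun v => ?_⟩, fun h0 => hF ?_⟩
    · change F *ᵥ (α.mat σ *ᵥ v) = liftOp m d (symIncl m σ) *ᵥ (F *ᵥ v)
      rw [Matrix.mulVec_mulVec, Matrix.mulVec_mulVec, h]
    · have := congrArg Representation.IntertwiningMap.toLinearMap h0
      refine Matrix.ext_of_mulVec_single fun i => ?_
      rw [Matrix.zero_mulVec]
      exact LinearMap.congr_fun this _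

/-- S(n-2) does not touch the last two factors, so they can be frozen where F has a nonzero entry
and replaced by the maximally entangled vector. -/
theorem exists_paired_intertwiner (hα : α.Occurs d) :
    ∃ F : Matrix (Fin (m + 2) → Fin d) (Fin α.dim) ℂ, F ≠ 0 ∧
      (∀ σ, liftOp m d (symIncl m σ) * F = F * α.mat σ) ∧ ∀ i, IsPaired fun z => F z i := by
  obtain ⟨F, hF, hint⟩ := α.occurs_iff.1 hα
  obtain ⟨z₀, i₀, h₀⟩ : ∃ z i, F z i ≠ 0 := by
    by_contra! h
    exact hF (Matrix.ext h)
  let e : (Fin (m + 2) → Fin d) → (Fin (m + 2) → Fin d) := fun z =>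
    Function.update (Function.update z (Fin.last m).castSucc (z₀ (Fin.last m).castSucc))
      (Fin.last (m + 1)) (z₀ (Fin.last (m + 1)))
  have he : ∀ z s, e (pairUpdate (Fin.last m) z s) = e z := by
    intro z s
    ext i
    refine congrArg _ (Fin.lastCases ?_ (fun i => Fin.lastCases ?_ (fun i => ?_) i) i)
    · simp [e]
    · simp [e, (Fin.castSucc_lt_last _).ne]
    · simp [e, (Fin.castSucc_lt_last _).ne, pairUpdate]
  have he₀ : e z₀ = z₀ := by simp [e]
  refine ⟨Matrix.of fun z i => if z (Fin.last m).castSucc = z (Fin.last (m + 1)) then F (e z) i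
    else 0, fun h => h₀ ?_, fun σ => ?_, fun i => ⟨fun z hz => ?_, fun z s hz => ?_⟩⟩
  · have := congrFun (congrFun h (pairUpdate (Fin.last m) z₀ (z₀ (Fin.last (m + 1))))) i₀
    simpa [he, he₀, pairUpdate_last, pairUpdate_castSucc] using this
  · ext z i
    have h := congrFun (congrFun (hint σ) (e z)) i
    rw [liftOp, MonoidHom.comp_apply, permOp_mul_apply] at h ⊢
    rw [pairUpdate_comp_symIncl] at h
    simp only [Matrix.of_apply, Function.comp_apply, symIncl_castSucc, symIncl_last,
      Matrix.mul_apply, ite_mul, zero_mul]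
    split_ifs
    · rw [Matrix.mul_apply] at h
      exact h
    · simp
  · simp [hz]
  · simp [he, pairUpdate_last, pairUpdate_castSucc, hz]

theorem exists_conjTranspose_mul_self {F : Matrix (Fin (m + 2) → Fin d) (Fin α.dim) ℂ}
    (hF : F ≠ 0) (hint : ∀ σ, liftOp m d (symIncl m σ) * F = F * α.mat σ) :
    ∃ c : ℂ, c ≠ 0 ∧ Fᴴ * F = c • 1 := by
  have h : ∀ σ, Fᴴ * liftOp m d (symIncl m σ) = α.mat σ * Fᴴ := by
    intro σ
    have := congrArg Matrix.conjTranspose (hint σ⁻¹)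
    rwa [Matrix.conjTranspose_mul, Matrix.conjTranspose_mul, liftOp_conjTranspose,
      mat_conjTranspose, inv_inv, ← map_inv, inv_inv] at this
  obtain ⟨c, hc⟩ := eq_smul_one_of_commute α.mat α.irreducible (Fᴴ * F) (by
    intro σ
    rw [Matrix.mul_assoc, ← hint, ← Matrix.mul_assoc, h, Matrix.mul_assoc])
  refine ⟨c, ?_, hc⟩
  rintro rfl
  rw [zero_smul, Matrix.conjTranspose_mul_self_eq_zero] at hc
  exact hF hc

/-- The diagonal elements with a = b = n-1 send a paired intertwiner F to d F E_ii; if all vanished,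
every column of F would too. -/
theorem u_ne_zero (hd : 1 ≤ d) (hα : α.Occurs d) :
    ∃ p q : Fin (m + 1) × Fin α.dim, α.u d p.1 q.1 p.2 q.2 ≠ 0 := by
  obtain ⟨F, hF, hint, hpair⟩ := α.exists_paired_intertwiner hα
  by_contra! h
  apply hF
  have hd0 : (d : ℂ) ≠ 0 := Nat.cast_ne_zero.2 (by omega)
  have key : ∀ i : Fin α.dim, F * Matrix.single i i (1 : ℂ) = 0 := by
    intro i
    have h0 := h (Fin.last m, i) (Fin.last m, i)
    rw [u_eq, swap_self, ← Perm.one_def, map_one, one_mul, mul_one, pairOp_last_mul_unitOp] at h0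
    have h1 := congrArg (fun X => X * F) h0
    simp only [Matrix.zero_mul] at h1
    rw [Matrix.mul_assoc, pairOp_mul_of_isPaired hpair, Matrix.mul_smul,
      α.unitOp_mul d F hint] at h1
    exact (smul_eq_zero.1 h1).resolve_left hd0
  ext z i
  have := congrFun (congrFun (key i) z) i
  simpa using this

/-- For x = ∑ X_pq u_pq the hypothesis gives x* x x* = 0, and positivity of the adjoint removes the
factors one at a time. Occurrence of φ^α plays no role in this direction. -/
theorem uMap_eq_zero_of_Q_mul_mul_Q
    {X : Matrix (Fin (m + 1) × Fin α.dim) (Fin (m + 1) × Fin α.dim) ℂ}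
    (h : α.Q d * X * α.Q d = 0) : α.uMap d X = 0 := by
  have h1 : (α.uMap d X)ᴴ * α.uMap d X * (α.uMap d X)ᴴ = 0 := by
    rw [uMap_conjTranspose, uMap_mul_uMap, uMap_mul_uMap]
    have : Xᴴ * α.Q d * X * α.Q d * Xᴴ = Xᴴ * (α.Q d * X * α.Q d) * Xᴴ := by
      simp only [mul_assoc]
    rw [this, h, mul_zero, zero_mul, map_zero]
  have h2 : ((α.uMap d X)ᴴ * α.uMap d X)ᴴ * ((α.uMap d X)ᴴ * α.uMap d X) = 0 := by
    rw [Matrix.conjTranspose_mul, Matrix.conjTranspose_conjTranspose, ← mul_assoc, h1, zero_mul]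
  rwa [Matrix.conjTranspose_mul_self_eq_zero, Matrix.conjTranspose_mul_self_eq_zero] at h2

theorem uMap_eq_zero_iff (hd : 1 ≤ d) (hα : α.Occurs d)
    {X : Matrix (Fin (m + 1) × Fin α.dim) (Fin (m + 1) × Fin α.dim) ℂ} :
    α.uMap d X = 0 ↔ α.Q d * X * α.Q d = 0 := by
  refine ⟨fun h => ?_, α.uMap_eq_zero_of_Q_mul_mul_Q⟩
  obtain ⟨p, q, hpq⟩ := α.u_ne_zero hd hα
  ext r s
  -- This is u_pr x u_sq, which equals (Q X Q)_rs u_pq, and u_pq is nonzero.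
  have h1 : α.uMap d (Matrix.single p r 1 * (α.Q d * X * α.Q d) * Matrix.single s q 1) = 0 := by
    have : Matrix.single p r 1 * (α.Q d * X * α.Q d) * Matrix.single s q 1 =
        Matrix.single p r 1 * α.Q d * X * α.Q d * Matrix.single s q 1 := by
      simp only [mul_assoc]
    rw [this, ← uMap_mul_uMap, ← uMap_mul_uMap, h, mul_zero, zero_mul]
  have h2 : Matrix.single p r 1 * (α.Q d * X * α.Q d) * Matrix.single s q 1 =
      (α.Q d * X * α.Q d) r s • Matrix.single p q (1 : ℂ) := by
    rw [Matrix.single_mul_mul_single, Matrix.smul_single]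
    simp
  rw [h2, map_smul, uMap_single] at h1
  exact (smul_eq_zero.1 h1).resolve_right hpq

theorem Q_diag (hd : 1 ≤ d) (p : Fin (m + 1) × Fin α.dim) : α.Q d p p ≠ 0 := by
  have h : hat (symIncl m) α.mat 1 = 1 := by
    have := hat_apply (symIncl m) (symIncl_injective m) α.mat 1
    rwa [map_one, map_one] at this
  rw [Q, Matrix.of_apply, swap_self, ← Perm.one_def, mul_one, swap_mul_self, h]
  have hd0 : d ≠ 0 := by omega
  simp [hd0]

/-! ### Minimal left ideals contained in `U(α)` -/

/-- The map `v ↦ ∑ v_p r_q u_{pq}(α)`. -/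
def colMap (d : ℕ) (r : Fin (m + 1) × Fin α.dim → ℂ) :
    (Fin (m + 1) × Fin α.dim → ℂ) →ₗ[ℂ] Op d (m + 2) where
  toFun v := α.uMap d (Matrix.vecMulVec v r)
  map_add' v w := by rw [Matrix.add_vecMulVec, map_add]
  map_smul' c v := by rw [Matrix.smul_vecMulVec, map_smul, RingHom.id_apply]

theorem colMap_apply (r v : Fin (m + 1) × Fin α.dim → ℂ) :
    α.colMap d r v = α.uMap d (Matrix.vecMulVec v r) := rfl

theorem uMap_mul_colMap (Y : Matrix (Fin (m + 1) × Fin α.dim) (Fin (m + 1) × Fin α.dim) ℂ)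
    (r v : Fin (m + 1) × Fin α.dim → ℂ) :
    α.uMap d Y * α.colMap d r v = α.colMap d r (Y *ᵥ (α.Q d *ᵥ v)) := by
  rw [colMap_apply, uMap_mul_uMap, Matrix.mul_vecMulVec, ← Matrix.mulVec_mulVec, colMap_apply]

theorem liftOp_mul_colMap (g : Perm (Fin (m + 1))) (r v : Fin (m + 1) × Fin α.dim → ℂ) :
    liftOp m d g * α.colMap d r v = α.colMap d r (α.ind g *ᵥ v) := by
  rw [colMap_apply, liftOp_mul_uMap, Matrix.mul_vecMulVec, colMap_apply]

theorem colMap_eq_zero_iff (hd : 1 ≤ d) (hα : α.Occurs d) {r : Fin (m + 1) × Fin α.dim → ℂ}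
    (hr : r ᵥ* α.Q d ≠ 0) (v : Fin (m + 1) × Fin α.dim → ℂ) :
    α.colMap d r v = 0 ↔ α.Q d *ᵥ v = 0 := by
  rw [colMap_apply, α.uMap_eq_zero_iff hd hα, Matrix.mul_vecMulVec, Matrix.vecMulVec_mul,
    Matrix.vecMulVec_eq_zero]
  exact or_iff_left hr

theorem isLeftIdeal_range_colMap (r : Fin (m + 1) × Fin α.dim → ℂ) :
    IsLeftIdeal m d (LinearMap.range (α.colMap d r)) where
  le := by
    rintro _ ⟨v, rfl⟩
    exact α.uMap_mem_algA d _
  mul_mem := by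
    rintro a ha _ ⟨v, rfl⟩
    obtain ⟨ρ, hρ⟩ := α.exists_mul_uMap d ha
    refine ⟨ρ *ᵥ v, ?_⟩
    rw [colMap_apply, colMap_apply, hρ, Matrix.mul_vecMulVec]

theorem exists_range_colMap_le {L : Submodule ℂ (Op d (m + 2))}
    (hL : IsLeftIdeal m d L) {x : Op d (m + 2)} (hxL : x ∈ L) (hxU : x ∈ α.idealU d)
    (hx : x ≠ 0) : ∃ r : Fin (m + 1) × Fin α.dim → ℂ, r ᵥ* α.Q d ≠ 0 ∧
      LinearMap.range (α.colMap d r) ≤ L := by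
  obtain ⟨X, rfl⟩ := (α.mem_idealU_iff d).1 hxU
  obtain ⟨p, hp⟩ : ∃ p, (α.Q d * X * α.Q d) p ≠ 0 := by
    by_contra! h
    exact hx (α.uMap_eq_zero_of_Q_mul_mul_Q (funext h))
  -- Multiplying x on the left by the element with coefficients v e_pᵀ replaces X by v times row p
  -- of Q X.
  refine ⟨(α.Q d * X) p, ?_, ?_⟩
  · rwa [← Matrix.mul_apply_eq_vecMul]
  · rintro _ ⟨v, rfl⟩
    have h := hL.mul_mem _ (α.uMap_mem_algA d (Matrix.vecMulVec v (Pi.single p 1))) _ hxL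
    rw [uMap_mul_uMap, Matrix.vecMulVec_mul, Matrix.vecMulVec_mul, Matrix.vecMul_vecMul,
      Matrix.single_one_vecMul] at h
    exact h

theorem isPhi_range_colMap (hd : 1 ≤ d) (hα : α.Occurs d) {r : Fin (m + 1) × Fin α.dim → ℂ}
    (hr : r ᵥ* α.Q d ≠ 0) : α.IsPhi d (LinearMap.range (α.colMap d r)) where
  toIsLeftIdeal := α.isLeftIdeal_range_colMap r
  ne_bot := by
    intro h
    have h0 : ∀ v, α.Q d *ᵥ v = 0 := fun v => by
      rw [← α.colMap_eq_zero_iff hd hα hr, LinearMap.range_eq_bot.1 h, LinearMap.zero_apply]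
    apply hr
    have : α.Q d = 0 := Matrix.ext_of_mulVec_single fun i => by rw [h0, Matrix.zero_mulVec]
    rw [this, Matrix.vecMul_zero]
  minimal := by
    intro L' hL' hle
    refine or_iff_not_imp_left.2 fun hne => le_antisymm hle ?_
    obtain ⟨x, hx, hx0⟩ := (Submodule.ne_bot_iff _).1 hne
    obtain ⟨v, rfl⟩ := hle hx
    rw [Ne, α.colMap_eq_zero_iff hd hα hr] at hx0
    obtain ⟨q, hq⟩ := Function.ne_iff.1 hx0
    rintro _ ⟨w, rfl⟩
    -- As (Q v)_q ≠ 0, left multiplication by this element carries the image of v to the image of w,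
    -- so any nonzero element generates everything.
    have h := hL'.mul_mem _ (α.uMap_mem_algA d
      (Matrix.vecMulVec (((α.Q d *ᵥ v) q)⁻¹ • w) (Pi.single q 1))) _ hx
    rw [uMap_mul_colMap, Matrix.vecMulVec_mulVec, single_one_dotProduct] at h
    have hq' : (α.Q d *ᵥ v) q ≠ 0 := hq
    simpa [smul_smul, hq'] using h
  le_idealU := by
    rintro _ ⟨v, rfl⟩
    exact (α.mem_idealU_iff d).2 ⟨_, rfl⟩

theorem exists_isPhi (hd : 1 ≤ d) (hα : α.Occurs d) : ∃ L, α.IsPhi d L := by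
  obtain ⟨i⟩ := nonempty_of_isIrreducible α.irreducible
  refine ⟨_, α.isPhi_range_colMap hd hα (r := Pi.single (Fin.last m, i) 1) fun h => ?_⟩
  have := congrFun h (Fin.last m, i)
  rw [Matrix.single_one_vecMul] at this
  exact α.Q_diag hd _ this

theorem exists_intertwiner (hd : 1 ≤ d) (hα : α.Occurs d) {L : Submodule ℂ (Op d (m + 2))}
    (hL : α.IsPhi d L) :
    ∃ f : (leftIdealRep hL.toIsLeftIdeal).IntertwiningMap (matRep α.ind),
      Function.Injective f ∧
      LinearMap.range f.toLinearMap = LinearMap.range (α.Q d).mulVecLin := by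
  obtain ⟨x, hxL, hx⟩ := (Submodule.ne_bot_iff _).1 hL.ne_bot
  obtain ⟨r, hr, hle⟩ := α.exists_range_colMap_le hL.toIsLeftIdeal hxL (hL.le_idealU hxL) hx
  have hLr : LinearMap.range (α.colMap d r) = L :=
    (hL.minimal _ (α.isLeftIdeal_range_colMap r) hle).resolve_left
      (α.isPhi_range_colMap hd hα hr).ne_bot
  have hmem : ∀ v, α.colMap d r v ∈ L := fun v => hLr ▸ ⟨v, rfl⟩
  let T : (Fin (m + 1) × Fin α.dim → ℂ) →ₗ[ℂ] L := (α.colMap d r).codRestrict L hmem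
  have hT : LinearMap.range T = ⊤ := by
    refine LinearMap.range_eq_top.2 fun y => ?_
    obtain ⟨v, hv⟩ := hLr.ge y.2
    exact ⟨v, Subtype.ext hv⟩
  have hT0 : ∀ v, T v = 0 ↔ α.Q d *ᵥ v = 0 := by
    intro v
    rw [← α.colMap_eq_zero_iff hd hα hr, ← Submodule.coe_eq_zero]
    rfl
  -- T and Q have the same kernel, so Q ∘ s does not depend on the linear section s, and
  -- equivariance of T and Q passes to it.
  obtain ⟨s, hs⟩ := T.exists_rightInverse_of_surjective hT
  have hs' : ∀ y, T (s y) = y := fun y => LinearMap.congr_fun hs y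
  have hfT : ∀ v, α.Q d *ᵥ s (T v) = α.Q d *ᵥ v := by
    intro v
    rw [← sub_eq_zero, ← Matrix.mulVec_sub, ← hT0, map_sub, hs', sub_self]
  refine ⟨⟨(α.Q d).mulVecLin ∘ₗ s, fun g => LinearMap.ext fun y => ?_⟩, ?_, ?_⟩
  · obtain ⟨v, rfl⟩ := LinearMap.range_eq_top.1 hT y
    have hg : leftIdealRep hL.toIsLeftIdeal g (T v) = T (α.ind g *ᵥ v) :=
      Subtype.ext (α.liftOp_mul_colMap g r v)
    change α.Q d *ᵥ s (leftIdealRep hL.toIsLeftIdeal g (T v)) = α.ind g *ᵥ (α.Q d *ᵥ s (T v))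
    rw [hg, hfT, hfT, Matrix.mulVec_mulVec, Matrix.mulVec_mulVec, ind_mul_Q]
  · refine (injective_iff_map_eq_zero ((α.Q d).mulVecLin ∘ₗ s)).2 fun y hy => ?_
    rw [← hs' y, hT0]
    exact hy
  · refine le_antisymm ?_ ?_
    · rintro _ ⟨y, rfl⟩
      exact ⟨s y, rfl⟩
    · rintro _ ⟨v, rfl⟩
      exact ⟨T v, hfT v⟩

/-! ### Minimal left ideals contained in `M` -/

theorem uMap_mul_mem_idealU (X : Matrix (Fin (m + 1) × Fin α.dim) (Fin (m + 1) × Fin α.dim) ℂ)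
    {x : Op d (m + 2)} (hx : x ∈ idealM m d) : α.uMap d X * x ∈ α.idealU d := by
  refine idealM_induction (p := fun x => α.uMap d X * x ∈ α.idealU d) ?_ ?_ ?_ ?_ hx
  · intro g a
    rw [mem_idealU_iff]
    -- Taking adjoints turns right multiplication by V(g) P_a into left multiplication by P_a
    -- V(g⁻¹).
    refine ⟨(Matrix.diagonal (fun p => if p.1 = a then 1 else 0) * α.Q d *
      (α.ind g⁻¹ * Xᴴ))ᴴ, ?_⟩
    rw [← uMap_conjTranspose, ← pairOp_mul_uMap, ← liftOp_mul_uMap]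
    simp only [Matrix.conjTranspose_mul, uMap_conjTranspose, Matrix.conjTranspose_conjTranspose,
      liftOp_conjTranspose, pairOp_conjTranspose, inv_inv, mul_assoc]
  · simp
  · intro x y hx hy
    rw [mul_add]
    exact add_mem hx hy
  · intro c x hx
    rw [Matrix.mul_smul]
    exact Submodule.smul_mem _ _ hx

end UnitaryIrrep

section

variable {m d : ℕ}

/-- If every P_a killed x, then y* x = 0 for all y in M, in particular x* x = 0. -/
theorem exists_pairOp_mul_ne_zero {x : Op d (m + 2)} (hx : x ∈ idealM m d) (h0 : x ≠ 0) :
    ∃ a, pairOp m d a * x ≠ 0 := by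
  by_contra! h
  apply h0
  rw [← Matrix.conjTranspose_mul_self_eq_zero]
  refine idealM_induction (p := fun y => yᴴ * x = 0) ?_ ?_ ?_ ?_ hx
  · intro g a
    rw [liftOp_mul_pairOp, Matrix.conjTranspose_mul, pairOp_conjTranspose, mul_assoc, h, mul_zero]
  · simp
  · intro y z hy hz
    rw [Matrix.conjTranspose_add, add_mul, hy, hz, add_zero]
  · intro c y hy
    rw [Matrix.conjTranspose_smul, Matrix.smul_mul, hy, smul_zero]

/-- A nonzero tensor has nonzero image under some `S(n-2)`-equivariant map to an irreducible
unitary representation. -/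
theorem exists_unitaryIrrep_intertwiner (v : (Fin (m + 2) → Fin d) → ℂ) (hv : v ≠ 0) :
    ∃ (α : UnitaryIrrep m) (p : Matrix (Fin α.dim) (Fin (m + 2) → Fin d) ℂ),
      (∀ σ, p * liftOp m d (symIncl m σ) = α.mat σ * p) ∧ p *ᵥ v ≠ 0 := by
  obtain ⟨w, φ, p, h1, h2, h3, h4⟩ := exists_irreducible_intertwiner
    ((liftOp m d).comp (symIncl m)) (fun σ => by
      rw [MonoidHom.comp_apply, liftOp_conjTranspose, ← map_inv]
      rfl) v hv
  exact ⟨⟨w, φ, h1, h2⟩, p, h3, h4⟩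

/-- Some matrix unit e_jj of some φ^α does not kill y = P_{n-1} V(a n-1) x, and e_jj y = u x for one
of the u of U(α). Thus u x is nonzero in L ∩ U(α), a left ideal, and minimality gives L ≤ U(α). -/
theorem exists_isPhi_of_isMinimalLeftIdeal (hd : 1 ≤ d) {L : Submodule ℂ (Op d (m + 2))}
    (hL : IsMinimalLeftIdeal m d L) (hLM : L ≤ idealM m d) :
    ∃ α : UnitaryIrrep m, α.IsPhi d L := by
  have hd0 : (d : ℂ) ≠ 0 := Nat.cast_ne_zero.2 (by omega)
  obtain ⟨x, hxL, hx⟩ := (Submodule.ne_bot_iff _).1 hL.ne_bot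
  obtain ⟨a, ha⟩ := exists_pairOp_mul_ne_zero (hLM hxL) hx
  let y := pairOp m d (Fin.last m) * (liftOp m d (swap a (Fin.last m)) * x)
  have hy : y = liftOp m d (swap a (Fin.last m)) * (pairOp m d a * x) := by
    rw [← mul_assoc, liftOp_mul_pairOp, swap_apply_left, mul_assoc]
  have hy0 : y ≠ 0 := by
    intro h
    apply ha
    rw [← one_mul (pairOp m d a * x), ← liftOp_swap_mul_self m d a (Fin.last m), mul_assoc, ← hy,
      h, mul_zero]
  obtain ⟨k, hk⟩ : ∃ k, yᵀ k ≠ 0 := by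
    by_contra! h
    exact hy0 (Matrix.transpose_injective (funext h))
  obtain ⟨α, p, hp, hpv⟩ := exists_unitaryIrrep_intertwiner _ hk
  obtain ⟨j, hj⟩ := Function.ne_iff.1 hpv
  refine ⟨α, ⟨hL, ?_⟩⟩
  have hne : α.unitOp d j j * y ≠ 0 := by
    intro h
    apply hj
    have h1 := congrArg (fun X => p * X) h
    simp only [Matrix.mul_zero] at h1
    rw [← Matrix.mul_assoc, α.mul_unitOp d p hp, Matrix.mul_assoc] at h1
    have h2 := congrFun (congrFun h1 j) k
    rw [Matrix.single_mul_apply_same, one_mul] at h2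
    exact h2
  have hu : α.u d (Fin.last m) a j j * x = α.unitOp d j j * y := by
    rw [UnitaryIrrep.u_eq, swap_self, ← Perm.one_def, map_one, one_mul,
      α.pairOp_last_mul_unitOp]
    simp only [y, mul_assoc]
  have hU : α.u d (Fin.last m) a j j * x ∈ α.idealU d := by
    rw [← α.uMap_single d (Fin.last m, j) (a, j)]
    exact α.uMap_mul_mem_idealU _ (hLM hxL)
  have hI : IsLeftIdeal m d (L ⊓ α.idealU d) :=
    ⟨inf_le_left.trans hL.le, by
      rintro b hb z ⟨hz, hz'⟩
      refine ⟨hL.mul_mem b hb z hz, ?_⟩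
      obtain ⟨X, rfl⟩ := (α.mem_idealU_iff d).1 hz'
      obtain ⟨ρ, hρ⟩ := α.exists_mul_uMap d hb
      exact (α.mem_idealU_iff d).2 ⟨_, (hρ X).symm⟩⟩
  refine inf_eq_left.1 ((hL.minimal _ hI inf_le_left).resolve_left ?_)
  refine (Submodule.ne_bot_iff _).2 ?_
  exact ⟨_, ⟨hL.mul_mem _ (α.u_mem_algA d _ _ _ _) x hxL, hU⟩, by rwa [hu]⟩

end

namespace UnitaryIrrep

variable {m : ℕ} (α : UnitaryIrrep m) {d : ℕ}

/-! ### Positivity of `Q(α)` for `d > n - 2` -/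

/-- A basis tensor with distinct entries in the first n-2 places has a free S(n-2)-orbit; its span
is the regular representation, which contains φ^α. -/
theorem occurs_of_lt (h : m < d) : α.Occurs d := by
  obtain ⟨i₀⟩ := nonempty_of_isIrreducible α.irreducible
  -- Only the first m places matter; the value 0 is filler for the last two when d is too small.
  let z₀ : Fin (m + 2) → Fin d := fun i => if hi : (i : ℕ) < d then ⟨i, hi⟩ else ⟨0, by omega⟩
  let c : Fin m → Fin (m + 2) := fun i => i.castSucc.castSucc
  have hinj : Function.Injective (z₀ ∘ c) := by
    intro i j hij
    have h1 : ∀ i : Fin m, (z₀ (c i) : ℕ) = i := by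
      intro i
      have : ((c i : Fin (m + 2)) : ℕ) < d := by
        have := i.2
        simp only [c, Fin.val_castSucc]
        omega
      simp only [z₀, dif_pos this]
      simp [c]
    have h2 := congrArg (Fin.val) hij
    rw [Function.comp_apply, Function.comp_apply, h1, h1] at h2
    exact Fin.ext h2
  refine α.occurs_iff.2 ⟨Matrix.of fun z k => ∑ σ : Perm (Fin m),
    if z ∘ c = z₀ ∘ c ∘ ⇑σ⁻¹ then α.mat σ⁻¹ i₀ k else 0, fun h0 => ?_, fun τ => ?_⟩
  · have h1 := congrFun (congrFun h0 z₀) i₀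
    rw [Matrix.of_apply, Finset.sum_eq_single 1] at h1
    · simp at h1
    · intro σ _ hσ
      rw [if_neg]
      intro h2
      apply hσ
      have h3 : ∀ i, σ⁻¹ i = i := fun i => (hinj (congrFun h2 i)).symm
      have h4 : σ⁻¹ = 1 := Equiv.ext h3
      exact inv_eq_one.1 h4
    · simp
  · ext z k
    rw [liftOp, MonoidHom.comp_apply, permOp_mul_apply, Matrix.mul_apply]
    simp only [Matrix.of_apply, Finset.sum_mul]
    rw [Finset.sum_comm]
    refine Fintype.sum_equiv (Equiv.mulLeft τ) _ _ fun σ => ?_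
    have hc : (z ∘ ⇑(symIncl (m + 1) (symIncl m τ))) ∘ c = (z ∘ c) ∘ τ := by
      ext i
      simp [c, symIncl_castSucc]
    have hiff : ((z ∘ c) ∘ τ = z₀ ∘ c ∘ ⇑σ⁻¹) = (z ∘ c = z₀ ∘ c ∘ ⇑(τ * σ)⁻¹) := by
      refine propext ⟨fun h => ?_, fun h => ?_⟩
      · ext i
        have := congrFun h (τ⁻¹ i)
        simp only [Function.comp_apply] at this
        rw [← Perm.mul_apply, mul_inv_cancel, Perm.one_apply] at this
        simp only [Function.comp_apply, mul_inv_rev, Perm.mul_apply]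
        rw [this]
      · rw [h]
        ext i
        simp only [Function.comp_apply, mul_inv_rev]
        rw [← Perm.mul_apply, inv_mul_cancel_right]
    simp only [hc, hiff, Equiv.coe_mulLeft]
    by_cases hz : z ∘ c = z₀ ∘ c ∘ ⇑(τ * σ)⁻¹
    · rw [if_pos hz]
      refine Eq.trans ?_ (Finset.sum_congr rfl fun x _ => congrArg (· * α.mat τ x k)
        (if_pos hz).symm)
      rw [← Matrix.mul_apply, ← map_mul, mul_inv_rev, inv_mul_cancel_right]
    · rw [if_neg hz]
      exact (Finset.sum_eq_zero fun x _ => mul_eq_zero_of_left (if_neg hz) _).symm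

theorem Q_apply (p q : Fin (m + 1) × Fin α.dim) : α.Q d p q = (if p.1 = q.1 then (d : ℂ) else 1) *
    hat (symIncl m) α.mat
      (swap p.1 (Fin.last m) * swap p.1 q.1 * swap q.1 (Fin.last m)) p.2 q.2 := rfl

/-- The operator `(v_a)_a ↦ ∑_a V(a n-1) F v_a`. -/
def sumOp (F : Matrix (Fin (m + 2) → Fin d) (Fin α.dim) ℂ) :
    Matrix (Fin (m + 2) → Fin d) (Fin (m + 1) × Fin α.dim) ℂ :=
  Matrix.of fun z p => (liftOp m d (swap p.1 (Fin.last m)) * F) z p.2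

/-- Replace d Fᴴ by Fᴴ P_{n-1}, apply `pairOp_mul_liftOp_mul`, and let Schur's scalar c absorb Fᴴ F.
-/
theorem conjTranspose_sumOp_mul_sumOp (hd : 1 ≤ d)
    {F : Matrix (Fin (m + 2) → Fin d) (Fin α.dim) ℂ}
    (hint : ∀ σ, liftOp m d (symIncl m σ) * F = F * α.mat σ)
    (hpair : ∀ i, IsPaired fun z => F z i) {c : ℂ} (hc : Fᴴ * F = c • 1) :
    (d : ℂ) • ((α.sumOp F)ᴴ * α.sumOp F) = c • α.Q d := by
  have hP := pairOp_mul_of_isPaired hpair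
  have hPH : Fᴴ * pairOp m d (Fin.last m) = (d : ℂ) • Fᴴ := by
    have := congrArg Matrix.conjTranspose hP
    rw [Matrix.conjTranspose_mul, pairOp_conjTranspose, Matrix.conjTranspose_smul] at this
    simpa using this
  ext ⟨a, i⟩ ⟨b, j⟩
  have h1 : ((α.sumOp F)ᴴ * α.sumOp F) (a, i) (b, j) =
      (Fᴴ * (liftOp m d (swap a (Fin.last m)) * (liftOp m d (swap b (Fin.last m)) * F))) i j := by
    have : Fᴴ * (liftOp m d (swap a (Fin.last m)) * (liftOp m d (swap b (Fin.last m)) * F)) =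
        (liftOp m d (swap a (Fin.last m)) * F)ᴴ * (liftOp m d (swap b (Fin.last m)) * F) := by
      rw [Matrix.conjTranspose_mul, liftOp_conjTranspose, swap_inv, Matrix.mul_assoc]
    rw [this]
    rfl
  have hfix : swap a (Fin.last m) * swap a b * swap b (Fin.last m) ∈ (symIncl m).range := by
    rw [mem_range_symIncl]
    simp
  obtain ⟨τ, hτ⟩ := hfix
  have h2 := congrArg (fun X => Fᴴ * X) (pairOp_mul_liftOp_mul hd hP a b)
  simp only [Matrix.mul_smul] at h2
  rw [← Matrix.mul_assoc, hPH, Matrix.smul_mul, ← hτ, hint, ← Matrix.mul_assoc Fᴴ F, hc,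
    Matrix.smul_mul, Matrix.one_mul] at h2
  rw [Matrix.smul_apply, h1, Matrix.smul_apply, Q_apply, ← Matrix.smul_apply, h2, ← hτ,
    hat_apply _ (symIncl_injective m)]
  simp only [Matrix.smul_apply, smul_eq_mul]
  ring

theorem sumOp_mulVec_apply (F : Matrix (Fin (m + 2) → Fin d) (Fin α.dim) ℂ)
    (v : Fin (m + 1) × Fin α.dim → ℂ) (z : Fin (m + 2) → Fin d) :
    (α.sumOp F *ᵥ v) z = ∑ a, (F *ᵥ fun i => v (a, i))
      (z ∘ ⇑(symIncl (m + 1) (swap a (Fin.last m)))) := by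
  simp only [Matrix.mulVec, dotProduct, sumOp, Matrix.of_apply, Fintype.sum_prod_type, liftOp,
    MonoidHom.comp_apply, permOp_mul_apply]

theorem sumOp_injective (h : m < d) {F : Matrix (Fin (m + 2) → Fin d) (Fin α.dim) ℂ}
    (hpair : ∀ i, IsPaired fun z => F z i) {c : ℂ} (hc0 : c ≠ 0) (hc : Fᴴ * F = c • 1) :
    Function.Injective (α.sumOp F).mulVec := by
  refine (injective_iff_map_eq_zero (α.sumOp F).mulVecLin).2 fun v hv => ?_
  have hF : ∀ a, (F *ᵥ fun i => v (a, i)) = 0 := by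
    intro a
    ext z
    have hp := fun b => IsPaired.mulVec hpair fun i => v (b, i)
    by_cases hz : z (Fin.last m).castSucc = z (Fin.last (m + 1))
    · obtain ⟨s, hs⟩ : ∃ s : Fin d, ∀ i : Fin m, z i.castSucc.castSucc ≠ s := by
        by_contra! hcon
        have := Fintype.card_le_of_surjective (fun i : Fin m => z i.castSucc.castSucc) hcon
        rw [Fintype.card_fin, Fintype.card_fin] at this
        omega
      rw [← (hp a).pairUpdate_eq z s hz]
      have h0 := congrFun hv
        (pairUpdate (Fin.last m) z s ∘ ⇑(symIncl (m + 1) (swap a (Fin.last m))))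
      rw [Matrix.mulVecLin_apply, sumOp_mulVec_apply, Finset.sum_eq_single a] at h0
      · rw [Function.comp_assoc, ← Perm.coe_mul, ← map_mul, swap_mul_self, map_one] at h0
        exact h0
      · intro b _ hb
        refine (hp b).eq_zero _ ?_
        simp only [Function.comp_apply, symIncl_castSucc, symIncl_last, swap_apply_right,
          pairUpdate_last, pairUpdate_castSucc]
        have hne : swap a (Fin.last m) b ≠ Fin.last m := by
          rw [Ne, swap_apply_eq_iff, swap_apply_right]
          exact hb
        rw [if_neg hne]
        obtain ⟨i, hi⟩ := Fin.exists_castSucc_eq.2 hne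
        rw [← hi]
        exact hs i
      · simp
    · exact (hp a).eq_zero z hz
  ext ⟨a, i⟩
  have h1 := congrArg (fun w => Fᴴ *ᵥ w) (hF a)
  simp only [Matrix.mulVec_mulVec, hc, Matrix.smul_mulVec, Matrix.one_mulVec,
    Matrix.mulVec_zero] at h1
  have h2 := congrFun h1 i
  rw [Pi.smul_apply, smul_eq_mul] at h2
  exact (mul_eq_zero.1 h2).resolve_left hc0

theorem Q_posDef (h : m < d) : (α.Q d).PosDef := by
  obtain ⟨F, hF, hint, hpair⟩ := α.exists_paired_intertwiner (α.occurs_of_lt h)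
  obtain ⟨c, hc0, hc⟩ := α.exists_conjTranspose_mul_self hF hint
  obtain ⟨i⟩ := nonempty_of_isIrreducible α.irreducible
  have hcpos : 0 < c := by
    refine lt_of_le_of_ne ?_ hc0.symm
    have := (Matrix.posSemidef_conjTranspose_mul_self F).diag_nonneg (i := i)
    rw [hc] at this
    simpa using this
  have hdpos : (0 : ℂ) < d := by
    have : 0 < d := by omega
    exact_mod_cast this
  have hQ : α.Q d = (c⁻¹ * d) • ((α.sumOp F)ᴴ * α.sumOp F) := by
    rw [← smul_smul, α.conjTranspose_sumOp_mul_sumOp (by omega) hint hpair hc, smul_smul,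
      inv_mul_cancel₀ hc0, one_smul]
  rw [hQ]
  exact (Matrix.PosDef.conjTranspose_mul_self _ (α.sumOp_injective h hpair hc0 hc)).smul
    (mul_pos (inv_pos.2 hcpos) hdpos)

end UnitaryIrrep

/-! ### A singular `Q(α)` for `d ≤ n - 2` -/

section Singular

variable {m d : ℕ}

/-- The 0-1 matrix with columns `e_{z_1}, …, e_{z_d}`. -/
def headMatrix (h : d ≤ m) (z : Fin (m + 2) → Fin d) : Matrix (Fin d) (Fin d) ℂ :=
  Matrix.of fun s j => if z (Fin.castLE h j).castSucc.castSucc = s then 1 else 0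

/-- The tensor antisymmetric in the first `d` factors and maximally entangled in the last two. -/
def detTensor (h : d ≤ m) : Matrix (Fin (m + 2) → Fin d) Unit ℂ :=
  Matrix.of fun z _ =>
    if z (Fin.last m).castSucc = z (Fin.last (m + 1)) then (headMatrix h z).det else 0

theorem isPaired_detTensor (h : d ≤ m) (i : Unit) : IsPaired fun z => detTensor h z i where
  eq_zero z hz := if_neg hz
  pairUpdate_eq z s hz := by
    have h1 : headMatrix h (pairUpdate (Fin.last m) z s) = headMatrix h z := by
      ext t j
      simp only [headMatrix, Matrix.of_apply, pairUpdate_castSucc, (Fin.castSucc_lt_last _).ne,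
        if_false]
    simp [detTensor, h1, hz, pairUpdate_last, pairUpdate_castSucc]

theorem detTensor_ne_zero (hd : 1 ≤ d) (h : d ≤ m) : detTensor h ≠ 0 := by
  intro h0
  let z : Fin (m + 2) → Fin d := fun i => if hi : (i : ℕ) < d then ⟨i, hi⟩ else ⟨0, hd⟩
  have h1 : headMatrix h z = 1 := by
    ext s j
    have : z (Fin.castLE h j).castSucc.castSucc = j := by simp [z]
    simp only [headMatrix, Matrix.of_apply, this, Matrix.one_apply, eq_comm]
  have h2 : z (Fin.last m).castSucc = z (Fin.last (m + 1)) := by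
    have h3 : ¬ m < d := by omega
    have h4 : ¬ m + 1 < d := by omega
    simp [z, h3, h4]
  have := congrFun (congrFun h0 z) ()
  simp [detTensor, h1, h2] at this

/-- Cramer's rule: swapping place j with n-1 replaces column j of `headMatrix` by the basis vector
at place n-1, and the identity is read off in row z_n. -/
theorem sum_liftOp_mul_detTensor (h : d ≤ m) :
    ∑ j : Fin d, liftOp m d (swap (Fin.castLE h j).castSucc (Fin.last m)) * detTensor h =
      detTensor h := by
  ext z i
  have hcr := congrFun (Matrix.mulVec_cramer (headMatrix h z)
    (fun s => if z (Fin.last m).castSucc = s then 1 else 0)) (z (Fin.last (m + 1)))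
  have hsum : ∀ j : Fin d,
      (liftOp m d (swap (Fin.castLE h j).castSucc (Fin.last m)) * detTensor h) z i =
      headMatrix h z (z (Fin.last (m + 1))) j * (headMatrix h z).cramer
        (fun s => if z (Fin.last m).castSucc = s then 1 else 0) j := by
    intro j
    have hm : headMatrix h (z ∘ ⇑(symIncl (m + 1) (swap (Fin.castLE h j).castSucc (Fin.last m)))) =
        (headMatrix h z).updateCol j (fun s => if z (Fin.last m).castSucc = s then 1 else 0) := by
      ext s k
      rw [Matrix.updateCol_apply]
      simp only [headMatrix, Matrix.of_apply, Function.comp_apply, symIncl_castSucc]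
      by_cases hk : k = j
      · subst hk
        simp
      · rw [if_neg hk, swap_apply_of_ne_of_ne _ (Fin.castSucc_lt_last _).ne]
        intro h'
        exact hk (Fin.castLE_injective h (Fin.castSucc_injective _ h'))
    rw [liftOp, MonoidHom.comp_apply, permOp_mul_apply, detTensor, Matrix.of_apply, hm,
      Matrix.cramer_apply]
    simp only [headMatrix, Matrix.of_apply, Function.comp_apply, symIncl_castSucc, symIncl_last,
      swap_apply_right, ite_mul, one_mul, zero_mul]
  rw [Matrix.sum_apply, Finset.sum_congr rfl fun j _ => hsum j]
  refine Eq.trans hcr ?_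
  simp [detTensor]

theorem exists_occurs_det_Q_eq_zero (hd : 1 ≤ d) (h : d ≤ m) :
    ∃ α : UnitaryIrrep m, α.Occurs d ∧ (α.Q d).det = 0 := by
  obtain ⟨α, p, hp, hpv⟩ := exists_unitaryIrrep_intertwiner (fun z => detTensor h z ()) (by
    intro h0
    exact detTensor_ne_zero hd h (Matrix.ext fun z _ => congrFun h0 z))
  have hP := pairOp_mul_of_isPaired (isPaired_detTensor (m := m) h)
  refine ⟨α, α.occurs_iff.2 ⟨pᴴ, ?_, fun σ => ?_⟩, ?_⟩
  · intro h0
    rw [Matrix.conjTranspose_eq_zero] at h0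
    exact hpv (by rw [h0, Matrix.zero_mulVec])
  · have := congrArg Matrix.conjTranspose (hp σ⁻¹)
    rwa [Matrix.conjTranspose_mul, Matrix.conjTranspose_mul, liftOp_conjTranspose,
      α.mat_conjTranspose, inv_inv, ← map_inv, inv_inv] at this
  -- The weights ε encode the Cramer relation ∑ ε_b V(b n-1) t = 0 for t = `detTensor h`. The kernel
  -- vector of Q is (b, j) ↦ ε_b (p t)_j, nonzero since its block at b = n-1 is p t.
  · let ε : Fin (m + 1) → ℂ := Pi.single (Fin.last m) 1 -
      ∑ j : Fin d, Pi.single (Fin.castLE h j).castSucc 1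
    have hε : ε (Fin.last m) = 1 := by
      unfold ε
      rw [Pi.sub_apply, Pi.single_eq_same, Finset.sum_apply, Finset.sum_eq_zero, sub_zero]
      exact fun j _ => Pi.single_eq_of_ne (Fin.castSucc_lt_last _).ne' _
    have hsum : ∑ b, ε b • (liftOp m d (swap b (Fin.last m)) * detTensor h) = 0 := by
      have h1 : ∀ c : Fin (m + 1), ∑ b, (Pi.single c 1 : Fin (m + 1) → ℂ) b •
          (liftOp m d (swap b (Fin.last m)) * detTensor h) =
          liftOp m d (swap c (Fin.last m)) * detTensor h := by
        intro c
        rw [Finset.sum_eq_single c]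
        · simp
        · intro b _ hb
          simp [hb]
        · simp
      simp only [ε, Pi.sub_apply, sub_smul, Finset.sum_sub_distrib, h1, Finset.sum_apply,
        Finset.sum_smul]
      rw [Finset.sum_comm, Finset.sum_congr rfl fun j _ => h1 _, sum_liftOp_mul_detTensor,
        swap_self, ← Perm.one_def, map_one, Matrix.one_mul, sub_self]
    refine Matrix.exists_mulVec_eq_zero_iff.1
      ⟨fun q => ε q.1 * (p * detTensor h) q.2 (), fun h0 => ?_, ?_⟩
    · apply hpv
      ext i
      have := congrFun h0 (Fin.last m, i)
      simp only [hε, one_mul] at this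
      exact this
    · ext ⟨a, i⟩
      -- Block b of Q times the vector is p P_{n-1} V(a n-1) applied to the b-th term of that
      -- relation, so the blocks sum to zero.
      have key : ∀ b, ∑ j, α.Q d (a, i) (b, j) * (ε b * (p * detTensor h) j ()) =
          (p * (pairOp m d (Fin.last m) * (liftOp m d (swap a (Fin.last m)) *
            (ε b • (liftOp m d (swap b (Fin.last m)) * detTensor h))))) i () := by
        intro b
        have hfix : swap a (Fin.last m) * swap a b * swap b (Fin.last m) ∈ (symIncl m).range := by
          rw [mem_range_symIncl]
          simp
        obtain ⟨τ, hτ⟩ := hfix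
        rw [Matrix.mul_smul, Matrix.mul_smul, pairOp_mul_liftOp_mul hd hP, ← hτ, Matrix.mul_smul,
          Matrix.mul_smul, ← Matrix.mul_assoc, hp, Matrix.mul_assoc, Matrix.smul_apply,
          Matrix.smul_apply, Matrix.mul_apply, smul_eq_mul, smul_eq_mul, Finset.mul_sum,
          Finset.mul_sum]
        refine Finset.sum_congr rfl fun j _ => ?_
        rw [UnitaryIrrep.Q_apply, ← hτ, hat_apply _ (symIncl_injective m)]
        ring
      change ∑ q : Fin (m + 1) × Fin α.dim, α.Q d (a, i) q * (ε q.1 * (p * detTensor h) q.2 ()) = 0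
      rw [Fintype.sum_prod_type, Finset.sum_congr rfl fun b _ => key b, ← Matrix.sum_apply,
        ← Matrix.mul_sum, ← Matrix.mul_sum, ← Matrix.mul_sum, hsum]
      simp

end Singular

end PartialTranspose

end

open PartialTranspose
theorem proposition33 (m d : ℕ) (hd : 1 ≤ d) :
    (m < d →
      (∀ α : UnitaryIrrep m, (α.Q d).PosDef ∧ (α.Q d).det ≠ 0) ∧
      (∀ L : Submodule ℂ (Op d (m + 2)), IsMinimalLeftIdeal m d L → L ≤ idealM m d →
        ∃ α : UnitaryIrrep m, α.IsPhi d L) ∧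
      (∀ α : UnitaryIrrep m,
        (∃ L : Submodule ℂ (Op d (m + 2)), α.IsPhi d L) ∧
        ∀ (L : Submodule ℂ (Op d (m + 2))) (hL : α.IsPhi d L),
          Nonempty ((leftIdealRep hL.toIsLeftIdeal).Equiv (matRep α.ind)) ∧
          Module.finrank ℂ L = (m + 1) * α.dim)) ∧
    (d ≤ m →
      (∃ α : UnitaryIrrep m, α.Occurs d ∧ (α.Q d).det = 0) ∧
      (∀ α : UnitaryIrrep m, α.Occurs d → (α.Q d).det = 0 →
        (∃ L : Submodule ℂ (Op d (m + 2)), α.IsPhi d L) ∧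
        ∀ (L : Submodule ℂ (Op d (m + 2))) (hL : α.IsPhi d L),
          ∃ f : (leftIdealRep hL.toIsLeftIdeal).IntertwiningMap (matRep α.ind),
            Function.Injective f ∧
            LinearMap.range f.toLinearMap = LinearMap.range (α.Q d).mulVecLin ∧
            LinearMap.range f.toLinearMap ≠ ⊤)) := by
  refine ⟨fun h => ?_, fun h => ⟨exists_occurs_det_Q_eq_zero hd h, fun α hα hdet => ?_⟩⟩
  · have hdet : ∀ α : UnitaryIrrep m, (α.Q d).det ≠ 0 := fun α => (α.Q_posDef h).det_pos.ne'
    refine ⟨fun α => ⟨α.Q_posDef h, hdet α⟩,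
      fun L hL hLM => exists_isPhi_of_isMinimalLeftIdeal hd hL hLM,
      fun α => ⟨α.exists_isPhi hd (α.occurs_of_lt h), fun L hL => ?_⟩⟩
    obtain ⟨f, hf, hrange⟩ := α.exists_intertwiner hd (α.occurs_of_lt h) hL
    have hsurj : Function.Surjective f := by
      have h1 : LinearMap.range f.toLinearMap = ⊤ := by
        rw [hrange]
        refine LinearMap.range_eq_top.2 ?_
        exact Matrix.mulVec_surjective_iff_isUnit.2
          ((Matrix.isUnit_iff_isUnit_det _).2 (hdet α).isUnit)
      exact LinearMap.range_eq_top.1 h1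
    refine ⟨⟨f.ofBijective ⟨hf, hsurj⟩⟩, ?_⟩
    rw [(LinearEquiv.ofBijective f.toLinearMap ⟨hf, hsurj⟩).finrank_eq]
    simp
  · refine ⟨α.exists_isPhi hd hα, fun L hL => ?_⟩
    obtain ⟨f, hf, hrange⟩ := α.exists_intertwiner hd hα hL
    refine ⟨f, hf, hrange, fun htop => ?_⟩
    rw [hrange, LinearMap.range_eq_top] at htop
    have := (Matrix.isUnit_iff_isUnit_det _).1 (Matrix.mulVec_surjective_iff_isUnit.1 htop)
    exact this.ne_zero hdet
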